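/- Let $\mathbb{Y}\subset\mathbb{R}^{d}$, let $\mu$ be a $\sigma$-finite measure on $\mathbb{Y}$, let $h:\mathbb{Y}\to[0,\infty)$ (not $\mu$-a.e. zero) and $T:\mathbb{Y}\to\mathbb{R}$ be measurable, and assume that the domain $\mathcal{D}=\{\theta\in\mathbb{R}:\int_{\mathbb{Y}} h(y)e^{\theta T(y)}\,\mu(dy)<\infty\}$ is open. For $\theta\in\mathcal{D}$ let $$f_\theta(y)=c(\theta)h(y)e^{\theta T(y)},\qquad c(\theta)^{-1}=\int_{\mathbb{Y}} h(y)e^{\theta T(y)}\,\mu(dy),$$ and let $P_\theta$ be the probability measure on $\mathbb{Y}$ with density $f_\theta$ with respect to $\mu$. Let $\Theta_0=[a,b]$ with $a\le b$, let $\Theta=[-K,K]\subset\mathcal{D}$ with $K>\max\{|a|,|b|\}$, and let $\Theta_1=\Theta\setminus\Theta_0$. Let $\Lambda_0$ and $\Lambda_1$ be probability measures on $\Theta_0$ and $\Theta_1$, let $\alpha\in(0,1)$, and let $g:[0,1]\to\mathbb{R}$ be continuous on $[0,1]$ and continuously differentiable on $(0,1)$ with $g'(t)>0$ for $0<t<1$.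 Let $\Delta$ be the set of measurable functions $\delta:\mathbb{Y}\to[0,1]$ (randomized decision rules; $\delta(y)$ is the probability of rejecting $\theta\in\Theta_0$ when $y$ is observed), and put $p(\theta;\delta)=\int_{\mathbb{Y}}\delta(y)f_\theta(y)\,\mu(dy)$. Consider the problem $$\max_{\delta\in\Delta}\ \int_{\Theta_1} g\big(p(\theta;\delta)\big)\,\Lambda_1(d\theta)\quad\text{subject to}\quad \int_{\Theta_0}p(\theta;\delta)\,\Lambda_0(d\theta)\le\alpha .$$ There exists an optimal rule $\delta^*$ for this problem such that $\int_{a}^{b}p(\theta;\delta^*)\,\Lambda_0(d\theta)=\alpha$ and such that, for some constants $-\infty\le\ell\le u\le\infty$ and a measurable function $\gamma:\mathbb{Y}\to[0,1]$, for every $y\in\mathbb{Y}$, $$\delta^*(y)=\begin{cases}1,&\text{if } T(y)>u\text{ or }T(y)<\ell,\\ \gamma(y),&\text{if }T(y)\in\{\ell,u\},\\ 0,&\text{if }\ell<T(y)<u.\end{cases}$$ Moreover, $\ell$ and $u$ can be chosen so that $\ell<u$, except possibly when $\ell=u=c$ for a real number $c$ such that, for one (equivalently, every) $\theta\in\mathcal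 D$, $P_\theta(T=c)>0$ and, for every $\varepsilon>0$, $P_\theta(c-\varepsilon<T<c)>0$ and $P_\theta(c<T<c+\varepsilon)>0$. -/

import Mathlib

open MeasureTheory Set

noncomputable section

namespace NPTest

variable {Y : Type*} [MeasurableSpace Y]

/-- A randomized decision rule: a measurable function with values in `[0, 1]`;
`δ y` is the probability of rejecting the null hypothesis when `y` is observed. -/
def IsDecisionRule (δ : Y → ℝ) : Prop :=
  Measurable δ ∧ ∀ y, δ y ∈ Icc (0 : ℝ) 1

/-- The power function `p(θ; δ) = ∫ δ(y) f_θ(y) μ(dy)`. -/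
def power (μ : Measure Y) (f : ℝ → Y → ℝ) (δ : Y → ℝ) (θ : ℝ) : ℝ :=
  ∫ y, δ y * f θ y ∂μ

/-- The average false-alarm probability `∫_{Θ₀} p(θ; δ) Λ₀(dθ)`. -/
def averageSize (μ : Measure Y) (f : ℝ → Y → ℝ) (Θ₀ : Set ℝ) (Λ₀ : Measure ℝ)
    (δ : Y → ℝ) : ℝ :=
  ∫ θ in Θ₀, power μ f δ θ ∂Λ₀

/-- The objective `∫_{Θ₁} g(p(θ; δ)) Λ₁(dθ)`. -/
def objective (μ : Measure Y) (f : ℝ → Y → ℝ) (g : ℝ → ℝ) (Θ₁ : Set ℝ) (Λ₁ : Measure ℝ)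
    (δ : Y → ℝ) : ℝ :=
  ∫ θ in Θ₁, g (power μ f δ θ) ∂Λ₁

/-- The feasible rules: average false-alarm probability at most `α`. -/
def IsFeasible (μ : Measure Y) (f : ℝ → Y → ℝ) (Θ₀ : Set ℝ) (Λ₀ : Measure ℝ) (α : ℝ)
    (δ : Y → ℝ) : Prop :=
  IsDecisionRule δ ∧ averageSize μ f Θ₀ Λ₀ δ ≤ α

/-- `δ` maximizes the objective among all feasible rules. -/
def IsOptimalRule (μ : Measure Y) (f : ℝ → Y → ℝ) (g : ℝ → ℝ) (Θ₀ Θ₁ : Set ℝ)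
    (Λ₀ Λ₁ : Measure ℝ) (α : ℝ) (δ : Y → ℝ) : Prop :=
  IsFeasible μ f Θ₀ Λ₀ α δ ∧
    ∀ δ' : Y → ℝ, IsFeasible μ f Θ₀ Λ₀ α δ' →
      objective μ f g Θ₁ Λ₁ δ' ≤ objective μ f g Θ₁ Λ₁ δ

/-- The natural parameter domain `{θ | ∫ h(y) e^{θ T(y)} μ(dy) < ∞}`
(for measurable `h ≥ 0` and measurable `T`). -/
def expDomain (μ : Measure Y) (h T : Y → ℝ) : Set ℝ :=
  {θ | Integrable (fun y => h y * Real.exp (θ * T y)) μ}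

/-- The exponential family density `f_θ(y) = c(θ) h(y) e^{θ T(y)}` with
`c(θ)⁻¹ = ∫ h(y) e^{θ T(y)} μ(dy)`. -/
def expDensity (μ : Measure Y) (h T : Y → ℝ) (θ : ℝ) (y : Y) : ℝ :=
  (∫ z, h z * Real.exp (θ * T z) ∂μ)⁻¹ * h y * Real.exp (θ * T y)

/-- The two-sided interval form: reject when `T y` lies outside `[l, u]`, accept when it lies
in `(l, u)`, and reject with probability `γ y` when it is one of the endpoints. -/
def IsTwoSidedForm (T : Y → ℝ) (l u : EReal) (γ δ : Y → ℝ) : Prop :=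
  ∀ y, (((T y : EReal) < l ∨ u < (T y : EReal)) → δ y = 1) ∧
    (((T y : EReal) = l ∨ (T y : EReal) = u) → δ y = γ y) ∧
    ((l < (T y : EReal) ∧ (T y : EReal) < u) → δ y = 0)

/-- The law of `T` under the base measure `h dμ`; it has the same null sets as the law of `T`
under each member of the exponential family. -/
def baseLaw (μ : Measure Y) (h T : Y → ℝ) : Measure ℝ :=
  (μ.withDensity fun y => ENNReal.ofReal (h y)).map T

/-- `c` is an atom of `ν` that every one-sided punctured neighbourhood charges,
on the left and on the right. -/
def IsTwoSidedAccumulatedAtom (ν : Measure ℝ) (c : ℝ) : Prop :=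
  0 < ν {c} ∧ ∀ ε : ℝ, 0 < ε → 0 < ν (Ioo (c - ε) c) ∧ 0 < ν (Ioo c (c + ε))

end NPTest

end

open Filter Topology

/-! Work under the measure `P` with density `h` with respect to `μ`, so that, up to normalization,
the power at `θ` is the integral of `δ` against `exp (θ * T)`.

Suppose `a < b`. Given any rule, a two-sided interval test with the same power at `a` and at `b` is
obtained by sliding an acceptance interval of fixed mass and using the intermediate value theorem
(`exists_isIntervalTest_integral_eq`). Put `X = exp ((b - a) * T)` and tilt `P` by `exp (a * T)`.
The difference `D` of the two tests is then orthogonal to `1` and `X`, nonnegative outside an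
interval and nonpositive inside it. Subtracting a chord shows that `D` has nonnegative integral
against every convex function of `X` (`IsIntervalTest.integral_sub_mul_nonneg`). Since `exp ((θ - a)
* T) = X ^ r` with `r = (θ - a) / (b - a)` is concave in `X` for `θ` in `[a, b]` and convex
otherwise, the interval test has no more power on `Θ₀` and no less on `Θ₁`. For `a = b`, let the
right endpoint decrease to `a` and extract a limit.

Only interval tests therefore matter. They are sequentially compact for pointwise convergence, so
dominated convergence yields an optimal one. Its size is exactly `α`, since otherwise mixing in
certain rejection would improve it. A degenerate acceptance interval can be widened over a null set
unless its point is an atom accumulated from both sides. -/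

namespace NPTest

/-! ### One-sided step functions and their attainable sizes. -/

/-- Nonincreasing `[0, 1]`-valued step functions that are constant `1`, then jump to `0`,
with an arbitrary value at the jump. -/
def IsLeftStep (L : ℝ → ℝ) : Prop :=
  (∀ x, L x ∈ Icc (0 : ℝ) 1) ∧ ∀ x y, x < y → 0 < L y → L x = 1

/-- `[0, 1]`-valued functions that are `1` outside an interval and `0` in its interior. -/
def IsIntervalTest (φ : ℝ → ℝ) : Prop :=
  (∀ x, φ x ∈ Icc (0 : ℝ) 1) ∧ ∀ x y z, x < y → y < z → φ x < 1 → φ z < 1 → φ y = 0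

namespace IsLeftStep

variable {L L' : ℝ → ℝ}

lemma eq_zero (hL : IsLeftStep L) {x y : ℝ} (hxy : x < y) (hx : L x < 1) : L y = 0 := by
  by_contra h
  exact hx.ne (hL.2 x y hxy (lt_of_le_of_ne (hL.1 y).1 (Ne.symm h)))

lemma antitone (hL : IsLeftStep L) : Antitone L := by
  intro x y hxy
  rcases hxy.eq_or_lt with rfl | hxy
  · exact le_rfl
  · by_cases hx : L x < 1
    · rw [hL.eq_zero hxy hx]; exact (hL.1 x).1
    · exact (hL.1 y).2.trans (not_lt.1 hx)

lemma measurable (hL : IsLeftStep L) : Measurable L := hL.antitone.measurable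

/-- Two step functions are comparable. -/
lemma le_of_lt (hL : IsLeftStep L) (hL' : IsLeftStep L') {x : ℝ} (hx : L x < L' x) : L ≤ L' := by
  intro y
  rcases lt_trichotomy y x with h | rfl | h
  · rw [hL'.2 y x h ((hL.1 x).1.trans_lt hx)]; exact (hL.1 y).2
  · exact hx.le
  · rw [hL.eq_zero h (hx.trans_le (hL'.1 x).2)]; exact (hL'.1 y).1

lemma const_zero : IsLeftStep (fun _ => 0) := by
  refine ⟨fun x => by simp, fun x y _ h => by simp at h⟩

lemma const_one : IsLeftStep (fun _ => 1) := by
  refine ⟨fun x => by simp, fun x y _ h => rfl⟩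

/-- A nonconstant step function has a threshold. -/
lemma exists_threshold (hL : IsLeftStep L) (h1 : ∃ x, L x < 1) (h0 : ∃ x, 0 < L x) :
    ∃ c, (∀ t < c, L t = 1) ∧ ∀ t > c, L t = 0 := by
  obtain ⟨x₁, h1⟩ := h1
  have hb : BddAbove {x | 0 < L x} := by
    refine ⟨x₁, fun y hy => ?_⟩
    by_contra hlt
    exact h1.ne (hL.2 _ _ (not_le.1 hlt) hy)
  refine ⟨sSup {x | 0 < L x}, fun t ht => ?_, fun t ht => ?_⟩
  · obtain ⟨y, hy, hty⟩ := exists_lt_of_lt_csSup h0 ht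
    exact hL.2 _ _ hty hy
  · by_contra h
    exact absurd (le_csSup hb (lt_of_le_of_ne (hL.1 t).1 (Ne.symm h))) (not_le.2 ht)

end IsLeftStep

/-- Step functions realize every intermediate value of the integral. -/
lemma exists_isLeftStep_integral_eq (ρ : Measure ℝ) [IsFiniteMeasure ρ] {s : ℝ}
    (hs : s ∈ Icc 0 (ρ.real univ)) : ∃ L, IsLeftStep L ∧ ∫ x, L x ∂ρ = s := by
  rcases hs.1.eq_or_lt with rfl | hs0
  · exact ⟨_, .const_zero, by simp⟩
  rcases hs.2.eq_or_lt with rfl | hs1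
  · exact ⟨_, .const_one, by simp⟩
  -- The threshold is the `s`-quantile `c = sInf A`. One-sided limits of the distribution function
  -- give `ρ (Iio c) ≤ s ≤ ρ (Iic c)`.
  set A : Set ℝ := {t | s ≤ ρ.real (Iic t)} with hA
  have hAne : A.Nonempty := by
    have h1 : Tendsto (fun t => ρ.real (Iic t)) atTop (𝓝 (ρ.real univ)) :=
      (ENNReal.tendsto_toReal (measure_ne_top _ _)).comp (tendsto_measure_Iic_atTop ρ)
    obtain ⟨t, ht⟩ := (h1.eventually (lt_mem_nhds hs1)).exists
    exact ⟨t, ht.le⟩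
  have hAb : BddBelow A := by
    have h1 : Tendsto (fun t => ρ.real (Iic t)) atBot (𝓝 0) := by
      have h2 := tendsto_measure_iInter_atBot (μ := ρ) (s := fun t : ℝ => Iic t)
        (fun _ => measurableSet_Iic.nullMeasurableSet) (fun i j hij => Iic_subset_Iic.2 hij)
        ⟨0, measure_ne_top _ _⟩
      have h3 : (⋂ t : ℝ, Iic t) = ∅ := by
        ext x
        simp only [mem_iInter, mem_Iic, mem_empty_iff_false, iff_false, not_forall, not_le]
        exact exists_lt x
      rw [h3, measure_empty] at h2
      rw [← ENNReal.toReal_zero]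
      exact (ENNReal.tendsto_toReal ENNReal.zero_ne_top).comp h2
    obtain ⟨t, ht⟩ := (h1.eventually (gt_mem_nhds hs0)).exists
    refine ⟨t, fun x hx => ?_⟩
    by_contra hlt
    have : ρ.real (Iic x) ≤ ρ.real (Iic t) := measureReal_mono (Iic_subset_Iic.2 (not_le.1 hlt).le)
    have hx' : s ≤ ρ.real (Iic x) := hx
    linarith
  set c := sInf A with hc
  have hmem : ∀ t, c < t → s ≤ ρ.real (Iic t) := by
    intro t ht
    obtain ⟨x, hx, hxt⟩ := exists_lt_of_csInf_lt hAne ht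
    exact le_trans hx (measureReal_mono (Iic_subset_Iic.2 hxt.le))
  have hle : s ≤ ρ.real (Iic c) := by
    have h1 : Tendsto (fun t => ρ (Iic t)) (𝓝[>] c) (𝓝 (ρ (⋂ r > c, Iic r))) :=
      tendsto_measure_biInter_gt (fun r _ => measurableSet_Iic.nullMeasurableSet)
        (fun i j _ hij => Iic_subset_Iic.2 hij) ⟨c + 1, by simp, measure_ne_top _ _⟩
    have h2 : (⋂ r > c, Iic r) = Iic c := by
      ext x
      simp only [mem_iInter, mem_Iic]
      exact ⟨fun h => le_of_forall_gt_imp_ge_of_dense h, fun h r hr => h.trans (le_of_lt hr)⟩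
    rw [h2] at h1
    refine ge_of_tendsto ((ENNReal.tendsto_toReal (measure_ne_top _ _)).comp h1) ?_
    filter_upwards [self_mem_nhdsWithin] with t ht using hmem t ht
  have hge : ρ.real (Iio c) ≤ s := by
    obtain ⟨v, hv, hvc, hvt⟩ := exists_seq_strictMono_tendsto c
    have h2 : (⋃ n, Iic (v n)) = Iio c := by
      ext x
      simp only [mem_iUnion, mem_Iic, mem_Iio]
      refine ⟨fun ⟨n, h⟩ => h.trans_lt (hvc n), fun h => ?_⟩
      obtain ⟨n, hn⟩ := (hvt.eventually (lt_mem_nhds h)).exists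
      exact ⟨n, hn.le⟩
    have h1 := tendsto_measure_iUnion_atTop (μ := ρ) (s := fun n => Iic (v n))
      (fun i j hij => Iic_subset_Iic.2 (hv.monotone hij))
    rw [h2] at h1
    refine le_of_tendsto ((ENNReal.tendsto_toReal (measure_ne_top _ _)).comp h1)
      (Eventually.of_forall fun n => ?_)
    by_contra hlt
    exact absurd (csInf_le hAb (show v n ∈ A from (not_le.1 hlt).le)) (not_le.2 (hvc n))
  have hsplit : ρ.real (Iic c) = ρ.real (Iio c) + ρ.real {c} := by
    rw [← Iio_union_right, measureReal_union (by simp) (measurableSet_singleton c)]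
  -- Randomizing on the possible atom at `c` supplies the missing mass; without an atom nothing is
  -- missing.
  obtain ⟨γ, hγ, hγs⟩ : ∃ γ ∈ Icc (0 : ℝ) 1, ρ.real (Iio c) + γ * ρ.real {c} = s := by
    rcases (measureReal_nonneg : 0 ≤ ρ.real {c}).eq_or_lt with h | h
    · exact ⟨0, by simp, by linarith⟩
    · refine ⟨(s - ρ.real (Iio c)) / ρ.real {c}, ⟨div_nonneg (by linarith) h.le, ?_⟩, ?_⟩
      · rw [div_le_one h]; linarith
      · field_simp; ring
  refine ⟨fun x => (Iio c).indicator (fun _ => 1) x + ({c} : Set ℝ).indicator (fun _ => γ) x,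
    ⟨fun x => ?_, fun x y hxy hy => ?_⟩, ?_⟩
  · rcases lt_trichotomy x c with h | rfl | h
    · simp [h, h.ne]
    · simpa using hγ
    · simp [h.le, h.ne']
  · have hyc : y ≤ c := by
      by_contra h
      push Not at h
      simp [h.le, h.ne'] at hy
    have := hxy.trans_le hyc
    simp [this, this.ne]
  · rw [integral_add, integral_indicator measurableSet_Iio,
      integral_indicator (measurableSet_singleton c)]
    · simp [← hγs, mul_comm, Measure.real]
    · exact (integrable_const _).indicator measurableSet_Iio
    · exact (integrable_const _).indicator (measurableSet_singleton c)

/-! ### Matching two moments of a rule by an interval test. -/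

section Moments

variable {Y : Type*} [MeasurableSpace Y] {P : Measure Y} {T : Y → ℝ}

lemma integrable_fun_sub {f g : Y → ℝ} (hf : Integrable f P) (hg : Integrable g P) :
    Integrable (fun y => f y - g y) P :=
  hf.sub hg

lemma integrable_mul_of_mem_Icc {δ w : Y → ℝ} (hδ : Measurable δ)
    (hδ01 : ∀ y, δ y ∈ Icc (0 : ℝ) 1) (hw : Integrable w P) :
    Integrable (fun y => δ y * w y) P := by
  refine hw.bdd_mul (c := 1) hδ.aestronglyMeasurable (Eventually.of_forall fun y => ?_)
  rw [Real.norm_eq_abs, abs_of_nonneg (hδ01 y).1]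
  exact (hδ01 y).2

lemma integrable_of_mem_Icc [IsFiniteMeasure P] {δ : Y → ℝ} (hδ : Measurable δ)
    (hδ01 : ∀ y, δ y ∈ Icc (0 : ℝ) 1) : Integrable δ P := by
  simpa using integrable_mul_of_mem_Icc hδ hδ01 (integrable_const (1 : ℝ))

lemma exists_isLeftStep_integral_comp_eq [IsFiniteMeasure P] (hT : Measurable T) {s : ℝ}
    (hs : s ∈ Icc 0 (P.real univ)) : ∃ L, IsLeftStep L ∧ ∫ y, L (T y) ∂P = s := by
  have hu : (P.map T).real univ = P.real univ := by
    simp [Measure.real, Measure.map_apply hT]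
  obtain ⟨L, hL, hLs⟩ := exists_isLeftStep_integral_eq (P.map T) (s := s) (by rwa [hu])
  refine ⟨L, hL, ?_⟩
  rw [← hLs, integral_map hT.aemeasurable hL.measurable.aestronglyMeasurable]

/-- Among tests of given size, a left step function minimizes the integral against any
nondecreasing function of the statistic. -/
lemma IsLeftStep.integral_mul_le [IsFiniteMeasure P] (hT : Measurable T) {X : ℝ → ℝ}
    (hX : Monotone X) (hXi : Integrable (fun y => X (T y)) P) {L : ℝ → ℝ} (hL : IsLeftStep L)
    {δ : Y → ℝ} (hδ : Measurable δ) (hδ01 : ∀ y, δ y ∈ Icc (0 : ℝ) 1)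
    (heq : ∫ y, L (T y) ∂P = ∫ y, δ y ∂P) :
    ∫ y, L (T y) * X (T y) ∂P ≤ ∫ y, δ y * X (T y) ∂P := by
  have hLm : Measurable fun y => L (T y) := hL.measurable.comp hT
  have hL01 : ∀ y, L (T y) ∈ Icc (0 : ℝ) 1 := fun y => hL.1 _
  have iL := integrable_of_mem_Icc (P := P) hLm hL01
  have iδ := integrable_of_mem_Icc (P := P) hδ hδ01
  have iLX := integrable_mul_of_mem_Icc hLm hL01 hXi
  have iδX := integrable_mul_of_mem_Icc hδ hδ01 hXi
  by_cases h1 : ∃ x, L x < 1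
  · by_cases h0 : ∃ x, 0 < L x
    · obtain ⟨c, hc1, hc0⟩ := hL.exists_threshold h1 h0
      -- The Neyman–Pearson argument: equal sizes make the subtraction of `X c` free, and both
      -- factors change sign at `c` in the same direction.
      have key : ∫ y, (δ y - L (T y)) * (X (T y) - X c) ∂P =
          ∫ y, δ y * X (T y) ∂P - ∫ y, L (T y) * X (T y) ∂P := by
        have : ∀ y, (δ y - L (T y)) * (X (T y) - X c) =
            (δ y * X (T y) - L (T y) * X (T y)) - X c * (δ y - L (T y)) := fun y => by ring
        simp_rw [this]
        rw [integral_sub (integrable_fun_sub iδX iLX) ((integrable_fun_sub iδ iL).const_mul _),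
          integral_sub iδX iLX,
          integral_const_mul, integral_sub iδ iL, heq]
        ring
      have : 0 ≤ ∫ y, (δ y - L (T y)) * (X (T y) - X c) ∂P := by
        refine integral_nonneg fun y => ?_
        show 0 ≤ (δ y - L (T y)) * (X (T y) - X c)
        rcases lt_trichotomy (T y) c with h | h | h
        · rw [hc1 _ h]
          exact mul_nonneg_of_nonpos_of_nonpos (by linarith [(hδ01 y).2])
            (by linarith [hX h.le])
        · simp [h]
        · rw [hc0 _ h]
          exact mul_nonneg (by linarith [(hδ01 y).1]) (by linarith [hX h.le])
      linarith
    · have hL0 : ∀ x, L x = 0 := fun x => le_antisymm (not_lt.1 fun h => h0 ⟨x, h⟩) (hL.1 x).1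
      simp only [hL0, integral_zero] at heq
      have := (integral_eq_zero_iff_of_nonneg (fun y => (hδ01 y).1) iδ).1 heq.symm
      refine le_of_eq (integral_congr_ae ?_)
      filter_upwards [this] with y hy
      rw [hL0, hy]; simp
  · have hL1 : ∀ x, L x = 1 := fun x => le_antisymm (hL.1 x).2 (not_lt.1 fun h => h1 ⟨x, h⟩)
    have h2 : ∫ y, (1 - δ y) ∂P = 0 := by
      rw [integral_sub (integrable_const _) iδ, ← heq]
      simp [hL1]
    have := (integral_eq_zero_iff_of_nonneg (fun y => by simpa using (hδ01 y).2)
      ((integrable_const _).sub iδ)).1 h2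
    refine le_of_eq (integral_congr_ae ?_)
    filter_upwards [this] with y hy
    have hy' : 1 - δ y = 0 := hy
    rw [hL1, show δ y = 1 by linarith]

/-- Left step functions are ordered as their integrals. -/
lemma IsLeftStep.le_of_integral_lt [IsFiniteMeasure P] (hT : Measurable T) {L L' : ℝ → ℝ}
    (hL : IsLeftStep L) (hL' : IsLeftStep L')
    (h : ∫ y, L (T y) ∂P < ∫ y, L' (T y) ∂P) : L ≤ L' := by
  have : ∃ x, L x < L' x := by
    by_contra! hcon
    exact absurd (integral_mono (integrable_of_mem_Icc (hL'.measurable.comp hT) fun y => hL'.1 _)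
      (integrable_of_mem_Icc (hL.measurable.comp hT) fun y => hL.1 _)
      fun y => hcon (T y)) (not_le.2 h)
  obtain ⟨x, hx⟩ := this
  exact hL.le_of_lt hL' hx

/-- The truncation tail: `X ≤ n + max (X - n) 0` replaces boundedness of `X` in the continuity
estimate for step functions. -/
lemma tendsto_integral_max_sub_zero {X : Y → ℝ} (hX : Integrable X P) :
    Tendsto (fun n : ℕ => ∫ y, max (X y - n) 0 ∂P) atTop (𝓝 0) := by
  have := tendsto_integral_of_dominated_convergence (μ := P)
    (F := fun (n : ℕ) y => max (X y - n) 0) (f := fun _ => 0) (fun y => |X y|)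
    (fun n => (hX.aestronglyMeasurable.sub aestronglyMeasurable_const).sup
      aestronglyMeasurable_const) hX.abs
    (fun n => Eventually.of_forall fun y => ?_) (Eventually.of_forall fun y => ?_)
  · simpa using this
  · rw [Real.norm_eq_abs, abs_of_nonneg (le_max_right _ _)]
    refine max_le ?_ (abs_nonneg _)
    have : (0 : ℝ) ≤ n := Nat.cast_nonneg n
    linarith [le_abs_self (X y)]
  · obtain ⟨N, hN⟩ := exists_nat_ge (X y)
    refine tendsto_const_nhds.congr' ?_
    filter_upwards [eventually_ge_atTop N] with n hn
    have : (N : ℝ) ≤ n := by exact_mod_cast hn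
    rw [max_eq_right (by linarith)]

/-- The integral of a fixed integrable function against left step functions depends
continuously on their size. -/
lemma continuousOn_integral_isLeftStep_mul [IsFiniteMeasure P] (hT : Measurable T) {X : Y → ℝ}
    (hX : Integrable X P) (hX0 : ∀ y, 0 ≤ X y) {S : Set ℝ} {L : ℝ → ℝ → ℝ}
    (hL : ∀ s ∈ S, IsLeftStep (L s)) (hLs : ∀ s ∈ S, ∫ y, L s (T y) ∂P = s) :
    ContinuousOn (fun s => ∫ y, L s (T y) * X y ∂P) S := by
  have hm : ∀ s ∈ S, Measurable fun y => L s (T y) := fun s hs => (hL s hs).measurable.comp hT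
  have iL : ∀ s ∈ S, Integrable (fun y => L s (T y)) P :=
    fun s hs => integrable_of_mem_Icc (hm s hs) fun y => (hL s hs).1 _
  have iLX : ∀ s ∈ S, Integrable (fun y => L s (T y) * X y) P :=
    fun s hs => integrable_mul_of_mem_Icc (hm s hs) (fun y => (hL s hs).1 _) hX
  set r : ℕ → ℝ := fun n => ∫ y, max (X y - n) 0 ∂P with hr
  -- The difference of steps lies in `[0, 1]` and has integral `t - s`; the part `n` of `X` costs `n
  -- * |s - t|`, the excess over `n` at most its own integral `r n`.
  have hstep : ∀ s ∈ S, ∀ t ∈ S, s < t → ∀ n : ℕ,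
      |(∫ y, L s (T y) * X y ∂P) - ∫ y, L t (T y) * X y ∂P| ≤ n * |s - t| + r n := by
    intro s hs t ht hst n
    have hle : L s ≤ L t := (hL s hs).le_of_integral_lt hT (P := P) (hL t ht)
      (by rw [hLs s hs, hLs t ht]; exact hst)
    have h1 : ∫ y, L s (T y) * X y ∂P ≤ ∫ y, L t (T y) * X y ∂P :=
      integral_mono (iLX s hs) (iLX t ht) fun y => mul_le_mul_of_nonneg_right (hle _) (hX0 y)
    have imax : Integrable (fun y => max (X y - n) 0) P :=
      (hX.sub (integrable_const _)).sup (integrable_const 0)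
    have h2 : ∫ y, L t (T y) * X y ∂P - ∫ y, L s (T y) * X y ∂P ≤
        ∫ y, (n * (L t (T y) - L s (T y)) + max (X y - n) 0) ∂P := by
      rw [← integral_sub (iLX t ht) (iLX s hs)]
      refine integral_mono ((iLX t ht).sub (iLX s hs))
        ((((iL t ht).sub (iL s hs)).const_mul _).add imax) fun y => ?_
      have a0 : 0 ≤ L t (T y) - L s (T y) := sub_nonneg.2 (hle _)
      have a1 : L t (T y) - L s (T y) ≤ 1 := by
        linarith [((hL t ht).1 (T y)).2, ((hL s hs).1 (T y)).1]
      have a2 := le_max_left (X y - n) 0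
      have a3 := le_max_right (X y - n) 0
      show L t (T y) * X y - L s (T y) * X y ≤ n * (L t (T y) - L s (T y)) + max (X y - n) 0
      nlinarith
    rw [integral_add ((integrable_fun_sub (iL t ht) (iL s hs)).const_mul _) imax,
      integral_const_mul,
      integral_sub (iL t ht) (iL s hs), hLs s hs, hLs t ht] at h2
    rw [abs_sub_comm, abs_of_nonneg (sub_nonneg.2 h1), abs_sub_comm,
      abs_of_nonneg (sub_nonneg.2 hst.le)]
    exact h2
  rw [Metric.continuousOn_iff]
  intro s hs ε hε
  obtain ⟨n, hn⟩ := ((tendsto_integral_max_sub_zero hX).eventually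
    (gt_mem_nhds (half_pos hε))).exists
  have hr0 : 0 ≤ r n := integral_nonneg fun y => le_max_right _ _
  have hn0 : (0 : ℝ) ≤ n := Nat.cast_nonneg n
  -- The `n + 1` keeps the denominator positive when `n = 0`.
  refine ⟨ε / (2 * (n + 1)), by positivity, fun t ht hts => ?_⟩
  rw [Real.dist_eq] at hts ⊢
  have hb : |(∫ y, L t (T y) * X y ∂P) - ∫ y, L s (T y) * X y ∂P| ≤ n * |t - s| + r n := by
    rcases lt_trichotomy t s with h | rfl | h
    · exact hstep t ht s hs h n
    · simpa using hr0
    · rw [abs_sub_comm, abs_sub_comm t]; exact hstep s hs t ht h n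
  have h3 : (n + 1) * |t - s| < ε / 2 := by
    rw [lt_div_iff₀ (by positivity)] at hts
    linarith
  have := abs_nonneg (t - s)
  have hn' : r n < ε / 2 := hn
  linarith

/-- The difference of two comparable left steps is one minus an interval test. -/
lemma IsLeftStep.isIntervalTest {L L' : ℝ → ℝ} (hL : IsLeftStep L) (hL' : IsLeftStep L')
    (hle : L ≤ L') : IsIntervalTest fun t => 1 - (L' t - L t) := by
  refine ⟨fun x => ⟨?_, ?_⟩, fun x y z hxy hyz hx hz => ?_⟩
  · linarith [(hL.1 x).1, (hL'.1 x).2]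
  · linarith [hle x]
  · have h1 : L y = 0 := hL.eq_zero hxy (by linarith [(hL'.1 x).2])
    have h2 : L' y = 1 := hL'.2 y z hyz (by linarith [(hL.1 z).1])
    simp [h1, h2]

/-- Every decision rule has the same two moments as some interval test. -/
lemma exists_isIntervalTest_integral_eq [IsFiniteMeasure P] (hT : Measurable T) {X : ℝ → ℝ}
    (hX : Monotone X) (hX0 : ∀ t, 0 ≤ X t) (hXi : Integrable (fun y => X (T y)) P)
    {δ : Y → ℝ} (hδ : Measurable δ) (hδ01 : ∀ y, δ y ∈ Icc (0 : ℝ) 1) :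
    ∃ φ : ℝ → ℝ, IsIntervalTest φ ∧ Measurable φ ∧ ∫ y, φ (T y) ∂P = ∫ y, δ y ∂P ∧
      ∫ y, φ (T y) * X (T y) ∂P = ∫ y, δ y * X (T y) ∂P := by
  set M := P.real univ with hM
  set m := ∫ y, δ y ∂P with hm
  have iδ := integrable_of_mem_Icc (P := P) hδ hδ01
  have iδX := integrable_mul_of_mem_Icc hδ hδ01 hXi
  have hm0 : 0 ≤ m := integral_nonneg fun y => (hδ01 y).1
  have hM1 : ∫ _, (1 : ℝ) ∂P = M := by simp [hM]
  have hmM : m ≤ M := by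
    rw [← hM1]
    exact integral_mono iδ (integrable_const _) fun y => (hδ01 y).2
  have hex : ∀ s : ℝ, ∃ L, s ∈ Icc 0 M → IsLeftStep L ∧ ∫ y, L (T y) ∂P = s := by
    intro s
    by_cases hs : s ∈ Icc 0 M
    · obtain ⟨L, hL⟩ := exists_isLeftStep_integral_comp_eq hT hs
      exact ⟨L, fun _ => hL⟩
    · exact ⟨0, fun h => absurd h hs⟩
  choose L hL using hex
  set Ψ : ℝ → ℝ := fun s => ∫ y, L s (T y) * X (T y) ∂P with hΨ
  have hcont : ContinuousOn Ψ (Icc 0 M) :=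
    continuousOn_integral_isLeftStep_mul hT hXi (fun y => hX0 _) (fun s hs => (hL s hs).1)
      fun s hs => (hL s hs).2
  -- `k` is the acceptance mass of `δ`. The tests `1 - (L (s + k) - L s)`, for `s` from `0` to `m`,
  -- all accept with mass `k` while the acceptance interval slides from left to right; `τ` is the
  -- `X`-moment of acceptance to be matched.
  set k := M - m with hk
  have hmem0 : (0 : ℝ) ∈ Icc 0 M := ⟨le_rfl, hm0.trans hmM⟩
  have hmemm : m ∈ Icc 0 M := ⟨hm0, hmM⟩
  have hmemM : M ∈ Icc 0 M := ⟨hm0.trans hmM, le_rfl⟩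
  have hmemk : k ∈ Icc 0 M := ⟨by linarith, by linarith⟩
  have hcont' : ContinuousOn (fun s => Ψ (s + k) - Ψ s) (Icc 0 m) := by
    refine ContinuousOn.sub (hcont.comp (by fun_prop) fun s hs => ?_)
      (hcont.mono (Icc_subset_Icc_right hmM))
    exact ⟨by linarith [hs.1], by linarith [hs.2]⟩
  have hLm : ∀ s ∈ Icc 0 M, Measurable fun y => L s (T y) :=
    fun s hs => (hL s hs).1.measurable.comp hT
  have iL : ∀ s ∈ Icc 0 M, Integrable (fun y => L s (T y)) P :=
    fun s hs => integrable_of_mem_Icc (hLm s hs) fun y => (hL s hs).1.1 _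
  have iLX : ∀ s ∈ Icc 0 M, Integrable (fun y => L s (T y) * X (T y)) P :=
    fun s hs => integrable_mul_of_mem_Icc (hLm s hs) (fun y => (hL s hs).1.1 _) hXi
  set τ := ∫ y, (1 - δ y) * X (T y) ∂P with hτ
  have hδ' : ∀ y, 1 - δ y ∈ Icc (0 : ℝ) 1 := fun y => ⟨by linarith [(hδ01 y).2],
    by linarith [(hδ01 y).1]⟩
  have hτ' : τ = ∫ y, X (T y) ∂P - ∫ y, δ y * X (T y) ∂P := by
    rw [hτ, ← integral_sub hXi iδX]
    congr 1; ext y; ring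
  have hΨ0 : Ψ 0 = 0 := by
    have := (integral_eq_zero_iff_of_nonneg (fun y => ((hL 0 hmem0).1.1 (T y)).1)
      (iL 0 hmem0)).1 (hL 0 hmem0).2
    rw [hΨ]
    refine integral_eq_zero_of_ae ?_
    filter_upwards [this] with y hy
    simp only [Pi.zero_apply] at hy ⊢
    rw [hy, zero_mul]
  have hΨM : Ψ M = ∫ y, X (T y) ∂P := by
    have h2 : ∫ y, (1 - L M (T y)) ∂P = 0 := by
      rw [integral_sub (integrable_const _) (iL M hmemM), (hL M hmemM).2, hM1, sub_self]
    have := (integral_eq_zero_iff_of_nonneg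
      (fun y => by simpa using ((hL M hmemM).1.1 (T y)).2)
      ((integrable_const _).sub (iL M hmemM))).1 h2
    refine integral_congr_ae ?_
    filter_upwards [this] with y hy
    have hy' : 1 - L M (T y) = 0 := hy
    rw [show L M (T y) = 1 by linarith, one_mul]
  -- Accepting at the far left minimizes the acceptance moment among tests of acceptance mass `k`.
  have hlo : Ψ (0 + k) - Ψ 0 ≤ τ := by
    rw [hΨ0, zero_add, sub_zero]
    refine (hL k hmemk).1.integral_mul_le hT hX hXi (measurable_const.sub hδ) hδ' ?_
    rw [(hL k hmemk).2, integral_sub (integrable_const _) iδ, hM1]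
  -- Accepting at the far right puts the rejection at the far left, which minimizes the rejection
  -- moment and so maximizes the acceptance moment.
  have hhi : τ ≤ Ψ (m + k) - Ψ m := by
    rw [show m + k = M by rw [hk]; ring, hΨM, hτ']
    have := (hL m hmemm).1.integral_mul_le hT hX hXi hδ hδ01 (hL m hmemm).2
    simp only [hΨ]
    linarith
  obtain ⟨s, hs, hsτ⟩ := intermediate_value_Icc hm0 hcont' ⟨hlo, hhi⟩
  have hs0 : s ∈ Icc 0 M := ⟨hs.1, hs.2.trans hmM⟩
  have hsk : s + k ∈ Icc 0 M := ⟨by linarith [hs.1, hmemk.1], by linarith [hs.2]⟩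
  -- For `k = 0` the strict comparison of sizes used below fails; then `τ = 0`, and always rejecting
  -- has the required moments.
  rcases hmemk.1.eq_or_lt with hk0 | hk0
  · refine ⟨fun _ => 1, ⟨fun x => by simp, fun x y z _ _ h => absurd h (lt_irrefl _)⟩,
      measurable_const, by rw [hM1]; linarith, ?_⟩
    have : Ψ (s + k) - Ψ s = τ := hsτ
    rw [← hk0, add_zero, sub_self] at this
    simp only [one_mul]
    linarith
  have hle : L s ≤ L (s + k) := (hL s hs0).1.le_of_integral_lt hT (P := P) (hL _ hsk).1
    (by rw [(hL s hs0).2, (hL _ hsk).2]; linarith)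
  refine ⟨fun t => 1 - (L (s + k) t - L s t), (hL s hs0).1.isIntervalTest (hL _ hsk).1 hle,
    measurable_const.sub ((hL _ hsk).1.measurable.sub (hL s hs0).1.measurable), ?_, ?_⟩
  · show ∫ y, (1 - (L (s + k) (T y) - L s (T y))) ∂P = m
    rw [integral_sub (integrable_const _) (integrable_fun_sub (iL _ hsk) (iL s hs0)),
      integral_sub (iL _ hsk) (iL s hs0), (hL s hs0).2, (hL _ hsk).2, hM1]
    linarith
  · have h1 : ∀ y, (1 - (L (s + k) (T y) - L s (T y))) * X (T y) =
      X (T y) - (L (s + k) (T y) * X (T y) - L s (T y) * X (T y)) := fun y => by ring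
    simp_rw [h1]
    rw [integral_sub hXi (integrable_fun_sub (iLX _ hsk) (iLX s hs0)),
      integral_sub (iLX _ hsk) (iLX s hs0)]
    have : Ψ (s + k) - Ψ s = τ := hsτ
    simp only [hΨ] at this
    linarith

end Moments

/-! ### Convexity and domination in an exponential family. -/

section Domination

variable {Y : Type*} [MeasurableSpace Y] {P : Measure Y}

lemma integral_affine_mul {D X : Y → ℝ} (hD : Integrable D P)
    (hDX : Integrable (fun y => D y * X y) P) (hD0 : ∫ y, D y ∂P = 0)
    (hDX0 : ∫ y, D y * X y ∂P = 0) (p q : ℝ) :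
    Integrable (fun y => D y * (p * X y + q)) P ∧ ∫ y, D y * (p * X y + q) ∂P = 0 := by
  have h : ∀ y, D y * (p * X y + q) = p * (D y * X y) + q * D y := fun y => by ring
  simp_rw [h]
  refine ⟨(hDX.const_mul _).add (hD.const_mul _), ?_⟩
  rw [integral_add (hDX.const_mul _) (hD.const_mul _), integral_const_mul, integral_const_mul,
    hD0, hDX0]
  ring

/-- A one-signed integrand with zero integral vanishes almost everywhere, so `D` lives on the set
where `p * X + q = 0`. There `k ∘ X` is constant (or, if `p = 0`, `D` itself is null). This settles
the cases where the acceptance region is empty or unbounded. -/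
lemma integral_mul_comp_eq_zero {D X : Y → ℝ} (hD : Integrable D P)
    (hDX : Integrable (fun y => D y * X y) P) (hD0 : ∫ y, D y ∂P = 0)
    (hDX0 : ∫ y, D y * X y ∂P = 0) {p q : ℝ} (hpq : p ≠ 0 ∨ q ≠ 0)
    (hsign : ∀ y, 0 ≤ D y * (p * X y + q)) (k : ℝ → ℝ) :
    ∫ y, D y * k (X y) ∂P = 0 := by
  obtain ⟨hi, h0⟩ := integral_affine_mul hD hDX hD0 hDX0 p q
  have hae := (integral_eq_zero_iff_of_nonneg hsign hi).1 h0
  by_cases hp : p = 0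
  · have hq : q ≠ 0 := by simpa [hp] using hpq
    refine integral_eq_zero_of_ae ?_
    filter_upwards [hae] with y hy
    have : D y = 0 := by simpa [hp, hq] using hy
    simp [this]
  · have : (fun y => D y * k (X y)) =ᵐ[P] fun y => D y * k (-q / p) := by
      filter_upwards [hae] with y hy
      rcases mul_eq_zero.1 hy with h | h
      · simp [h]
      · rw [show X y = -q / p by rw [eq_div_iff hp]; linarith]
    rw [integral_congr_ae this, integral_mul_const, hD0, zero_mul]

/-- A convex function lies below its chord between the endpoints and above it outside; when the
endpoints coincide the chord is replaced by a tangent. -/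
lemma exists_chord {k : ℝ → ℝ} (hk : ConvexOn ℝ (Ioi 0) k)
    (hk' : ∀ x > 0, DifferentiableAt ℝ k x) {v w : ℝ} (hv : 0 < v) (hvw : v ≤ w) :
    ∃ r p q : ℝ, 0 < r ∧ (∀ x > 0, x < v ∨ w < x → 0 ≤ r * k x + (p * x + q)) ∧
      (∀ x, v < x → x < w → r * k x + (p * x + q) ≤ 0) ∧
      r * k v + (p * v + q) = 0 ∧ r * k w + (p * w + q) = 0 := by
  rcases hvw.eq_or_lt with rfl | hlt
  · refine ⟨1, -deriv k v, deriv k v * v - k v, one_pos, fun x hx0 hx => ?_, fun x h1 h2 =>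
      absurd (h1.trans h2) (lt_irrefl _), by ring, by ring⟩
    rcases hx with hx | hx
    · have := hk.slope_le_of_hasDerivAt (mem_Ioi.2 hx0) (mem_Ioi.2 hv) hx (hk' v hv).hasDerivAt
      rw [slope_def_field, div_le_iff₀ (by linarith)] at this
      linarith
    · have := hk.le_slope_of_hasDerivAt (mem_Ioi.2 hv) (mem_Ioi.2 hx0) hx (hk' v hv).hasDerivAt
      rw [slope_def_field, le_div_iff₀ (by linarith)] at this
      linarith
  -- The chord equation is multiplied by `w - v` to clear its denominator.
  · refine ⟨w - v, k v - k w, v * k w - w * k v, by linarith, fun x hx0 hx => ?_,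
      fun x h1 h2 => ?_, by ring, by ring⟩
    · rcases hx with hx | hx
      · have := hk.secant_mono_aux1 (mem_Ioi.2 hx0) (mem_Ioi.2 (hv.trans hlt)) hx hlt
        linarith
      · have := hk.secant_mono_aux1 (mem_Ioi.2 hv) (mem_Ioi.2 hx0) hlt hx
        linarith
    · have := hk.secant_mono_aux1 (mem_Ioi.2 hv) (mem_Ioi.2 (hv.trans hlt)) h1 h2
      linarith

/-- Orthogonality to `1` and `X` allows adding an affine function of `X` to `k` without changing the
integral. With the chord over `[v, w]` removed, `k` has the same sign pattern as `D`, so the product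
is pointwise nonnegative. -/
lemma integral_mul_comp_nonneg_of_convexOn {D X : Y → ℝ} (hX : ∀ y, 0 < X y) (hD : Integrable D P)
    (hDX : Integrable (fun y => D y * X y) P) (hD0 : ∫ y, D y ∂P = 0)
    (hDX0 : ∫ y, D y * X y ∂P = 0) {k : ℝ → ℝ} (hk : ConvexOn ℝ (Ioi 0) k)
    (hk' : ∀ x > 0, DifferentiableAt ℝ k x) (hDk : Integrable (fun y => D y * k (X y)) P)
    {v w : ℝ} (hv : 0 < v) (hvw : v ≤ w) (hout : ∀ y, X y < v ∨ w < X y → 0 ≤ D y)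
    (hin : ∀ y, v < X y → X y < w → D y ≤ 0) : 0 ≤ ∫ y, D y * k (X y) ∂P := by
  obtain ⟨r, p, q, hr, h1, h2, h3, h4⟩ := exists_chord hk hk' hv hvw
  obtain ⟨hi, h0⟩ := integral_affine_mul hD hDX hD0 hDX0 p q
  have key : 0 ≤ ∫ y, (r * (D y * k (X y)) + D y * (p * X y + q)) ∂P := by
    refine integral_nonneg fun y => ?_
    show 0 ≤ r * (D y * k (X y)) + D y * (p * X y + q)
    rw [show r * (D y * k (X y)) + D y * (p * X y + q) =
      D y * (r * k (X y) + (p * X y + q)) by ring]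
    by_cases ho : X y < v ∨ w < X y
    · exact mul_nonneg (hout y ho) (h1 _ (hX y) ho)
    · push Not at ho
      rcases ho.1.eq_or_lt with h | hl
      · rw [← h, h3, mul_zero]
      rcases ho.2.eq_or_lt with h | hu
      · rw [h, h4, mul_zero]
      exact mul_nonneg_of_nonpos_of_nonpos (hin y hl hu) (h2 _ hl hu)
  rw [integral_add (hDk.const_mul _) hi, h0, integral_const_mul, add_zero] at key
  exact nonneg_of_mul_nonneg_right key hr

lemma IsIntervalTest.eq_one_of_lt_sInf {φ : ℝ → ℝ} (hφ : IsIntervalTest φ)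
    (hb : BddBelow {x | φ x < 1}) {t : ℝ} (ht : t < sInf {x | φ x < 1}) : φ t = 1 := by
  by_contra h
  exact absurd (csInf_le hb (lt_of_le_of_ne (hφ.1 t).2 h)) (not_le.2 ht)

lemma IsIntervalTest.eq_one_of_sSup_lt {φ : ℝ → ℝ} (hφ : IsIntervalTest φ)
    (hb : BddAbove {x | φ x < 1}) {t : ℝ} (ht : sSup {x | φ x < 1} < t) : φ t = 1 := by
  by_contra h
  exact absurd (le_csSup hb (lt_of_le_of_ne (hφ.1 t).2 h)) (not_le.2 ht)

/-- An interval test crosses a decision rule with the same two moments in such a way that their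
difference has nonnegative integral against convex functions. -/
lemma IsIntervalTest.integral_sub_mul_nonneg {T D : Y → ℝ} {φ X : ℝ → ℝ}
    (hφ : IsIntervalTest φ) (hD1 : ∀ y, φ (T y) = 1 → 0 ≤ D y)
    (hD0 : ∀ y, φ (T y) = 0 → D y ≤ 0) (hX : StrictMono X) (hX0 : ∀ t, 0 < X t)
    (hD : Integrable D P) (hDX : Integrable (fun y => D y * X (T y)) P) (hDz : ∫ y, D y ∂P = 0)
    (hDXz : ∫ y, D y * X (T y) ∂P = 0) {k : ℝ → ℝ} (hk : ConvexOn ℝ (Ioi 0) k)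
    (hk' : ∀ x > 0, DifferentiableAt ℝ k x) (hDk : Integrable (fun y => D y * k (X (T y))) P) :
    0 ≤ ∫ y, D y * k (X (T y)) ∂P := by
  set A : Set ℝ := {x | φ x < 1} with hA
  -- Unless the acceptance set is nonempty and bounded, `D` changes sign at most once, and an affine
  -- function of `X` already matches its sign.
  have zero : ∀ {p q : ℝ}, p ≠ 0 ∨ q ≠ 0 → (∀ y, 0 ≤ D y * (p * X (T y) + q)) →
      0 ≤ ∫ y, D y * k (X (T y)) ∂P := fun hpq hs =>
    (integral_mul_comp_eq_zero hD hDX hDz hDXz hpq hs k).ge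
  rcases A.eq_empty_or_nonempty with hAe | hAne
  · refine zero (p := 0) (q := 1) (by simp) fun y => ?_
    have : φ (T y) = 1 := by
      by_contra h
      have : T y ∈ A := lt_of_le_of_ne (hφ.1 _).2 h
      simp [hAe] at this
    simpa using hD1 y this
  by_cases hbb : BddBelow A <;> by_cases hba : BddAbove A
  · refine integral_mul_comp_nonneg_of_convexOn (v := X (sInf A)) (w := X (sSup A))
      (fun y => hX0 _) hD hDX hDz hDXz hk hk' hDk (hX0 _)
      (hX.monotone (csInf_le_csSup hAne hbb hba)) (fun y hy => ?_) fun y hy1 hy2 => ?_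
    · rw [hX.lt_iff_lt, hX.lt_iff_lt] at hy
      rcases hy with hy | hy
      · exact hD1 y (hφ.eq_one_of_lt_sInf hbb hy)
      · exact hD1 y (hφ.eq_one_of_sSup_lt hba hy)
    · rw [hX.lt_iff_lt] at hy1 hy2
      obtain ⟨x, hx, hxy⟩ := exists_lt_of_csInf_lt hAne hy1
      obtain ⟨z, hz, hyz⟩ := exists_lt_of_lt_csSup hAne hy2
      exact hD0 y (hφ.2 _ _ _ hxy hyz hx hz)
  · refine zero (p := -1) (q := X (sInf A)) (by simp) fun y => ?_
    rcases lt_trichotomy (T y) (sInf A) with h | h | h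
    · exact mul_nonneg (hD1 y (hφ.eq_one_of_lt_sInf hbb h)) (by linarith [hX h])
    · rw [h]; simp
    · obtain ⟨x, hx, hxy⟩ := exists_lt_of_csInf_lt hAne h
      obtain ⟨z, hz, hyz⟩ := not_bddAbove_iff.1 hba (T y)
      exact mul_nonneg_of_nonpos_of_nonpos (hD0 y (hφ.2 _ _ _ hxy hyz hx hz))
        (by linarith [hX h])
  · refine zero (p := 1) (q := -X (sSup A)) (by simp) fun y => ?_
    rcases lt_trichotomy (T y) (sSup A) with h | h | h
    · obtain ⟨x, hx, hxy⟩ := not_bddBelow_iff.1 hbb (T y)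
      obtain ⟨z, hz, hyz⟩ := exists_lt_of_lt_csSup hAne h
      exact mul_nonneg_of_nonpos_of_nonpos (hD0 y (hφ.2 _ _ _ hxy hyz hx hz))
        (by linarith [hX h])
    · rw [h]; simp
    · exact mul_nonneg (hD1 y (hφ.eq_one_of_sSup_lt hba h)) (by linarith [hX h])
  · refine zero (p := 0) (q := -1) (by simp) fun y => ?_
    obtain ⟨x, hx, hxy⟩ := not_bddBelow_iff.1 hbb (T y)
    obtain ⟨z, hz, hyz⟩ := not_bddAbove_iff.1 hba (T y)
    have := hD0 y (hφ.2 _ _ _ hxy hyz hx hz)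
    linarith

/-- The sign `σ` treats convex and concave powers together. -/
lemma convexOn_mul_rpow {σ r : ℝ} (h : 0 ≤ σ * (r * (r - 1))) :
    ConvexOn ℝ (Ioi 0) fun x : ℝ => σ * x ^ r := by
  refine convexOn_of_hasDerivWithinAt2_nonneg (f' := fun x => σ * (r * x ^ (r - 1)))
    (f'' := fun x => σ * (r * ((r - 1) * x ^ (r - 1 - 1)))) (convex_Ioi 0) ?_ ?_ ?_ ?_
  · exact fun x hx => ((Real.continuousAt_rpow_const x r (Or.inl (ne_of_gt hx))).const_mul
      σ).continuousWithinAt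
  · intro x hx
    rw [interior_Ioi] at hx
    exact ((Real.hasDerivAt_rpow_const (Or.inl (ne_of_gt hx))).const_mul σ).hasDerivWithinAt
  · intro x hx
    rw [interior_Ioi] at hx
    exact (((Real.hasDerivAt_rpow_const (Or.inl (ne_of_gt hx))).const_mul r).const_mul
      σ).hasDerivWithinAt
  · intro x hx
    rw [interior_Ioi] at hx
    have := mul_nonneg h (Real.rpow_nonneg (le_of_lt hx) (r - 1 - 1))
    linarith

lemma integral_withDensity_ofReal {w : Y → ℝ} (hw : Measurable w) (hw0 : ∀ y, 0 ≤ w y)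
    (f : Y → ℝ) :
    ∫ y, f y ∂(P.withDensity fun y => ENNReal.ofReal (w y)) = ∫ y, f y * w y ∂P := by
  rw [integral_withDensity_eq_integral_toReal_smul hw.ennreal_ofReal (by simp)]
  simp_rw [ENNReal.toReal_ofReal (hw0 _), smul_eq_mul, mul_comm]

lemma integrable_withDensity_ofReal {w : Y → ℝ} (hw : Measurable w) (hw0 : ∀ y, 0 ≤ w y)
    {f : Y → ℝ} :
    Integrable f (P.withDensity fun y => ENNReal.ofReal (w y)) ↔
      Integrable (fun y => f y * w y) P := by
  rw [integrable_withDensity_iff_integrable_smul' hw.ennreal_ofReal (by simp)]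
  simp_rw [ENNReal.toReal_ofReal (hw0 _), smul_eq_mul, mul_comm]

/-- In a one-parameter exponential family, every decision rule is dominated by an interval test
with the same power at two given parameter values. -/
lemma exists_isIntervalTest_dominating_of_lt {T : Y → ℝ} (hT : Measurable T) {a b : ℝ}
    (hab : a < b) (ha : Integrable (fun y => Real.exp (a * T y)) P)
    (hb : Integrable (fun y => Real.exp (b * T y)) P) {δ : Y → ℝ} (hδ : IsDecisionRule δ) :
    ∃ φ : ℝ → ℝ, IsIntervalTest φ ∧ Measurable φ ∧
      ∀ θ, Integrable (fun y => Real.exp (θ * T y)) P →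
        (θ ∈ Icc a b →
          ∫ y, φ (T y) * Real.exp (θ * T y) ∂P ≤ ∫ y, δ y * Real.exp (θ * T y) ∂P) ∧
        (θ ∉ Ioo a b →
          ∫ y, δ y * Real.exp (θ * T y) ∂P ≤ ∫ y, φ (T y) * Real.exp (θ * T y) ∂P) := by
  have hw : ∀ θ : ℝ, Measurable fun y => Real.exp (θ * T y) := fun θ => by fun_prop
  have hw0 : ∀ (θ : ℝ) y, 0 ≤ Real.exp (θ * T y) := fun θ y => (Real.exp_pos _).le
  -- Tilting by `exp (a * T)` gives a finite measure, and matching powers at `a` and `b` becomes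
  -- matching the integrals of `1` and `X`.
  set Q := P.withDensity fun y => ENNReal.ofReal (Real.exp (a * T y)) with hQ
  have hshift : ∀ θ y, Real.exp ((θ - a) * T y) * Real.exp (a * T y) = Real.exp (θ * T y) :=
    fun θ y => by rw [← Real.exp_add]; ring_nf
  have hint : ∀ (f : Y → ℝ) (θ : ℝ), ∫ y, f y * Real.exp ((θ - a) * T y) ∂Q =
      ∫ y, f y * Real.exp (θ * T y) ∂P := fun f θ => by
    rw [hQ, integral_withDensity_ofReal (hw a) (hw0 a)]
    simp_rw [mul_assoc, hshift]
  have hible : ∀ θ : ℝ, Integrable (fun y => Real.exp (θ * T y)) P →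
      Integrable (fun y => Real.exp ((θ - a) * T y)) Q := fun θ hθ => by
    rw [hQ, integrable_withDensity_ofReal (hw a) (hw0 a)]
    simpa only [hshift] using hθ
  have : IsFiniteMeasure Q := by
    have := hible a ha
    simp only [sub_self, zero_mul, Real.exp_zero] at this
    simpa [integrable_const_iff] using this
  set X : ℝ → ℝ := fun t => Real.exp ((b - a) * t) with hX
  have hXm : StrictMono X := fun s t hst =>
    Real.exp_lt_exp.2 (mul_lt_mul_of_pos_left hst (sub_pos.2 hab))
  obtain ⟨φ, hφ, hφm, h0, h1⟩ := exists_isIntervalTest_integral_eq hT hXm.monotone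
    (fun t => (Real.exp_pos _).le) (hible b hb) hδ.1 hδ.2
  refine ⟨φ, hφ, hφm, fun θ hθ => ?_⟩
  have hφT : Measurable fun y => φ (T y) := hφm.comp hT
  have iθφ := integrable_mul_of_mem_Icc hφT (fun y => hφ.1 _) (hible θ hθ)
  have iθδ := integrable_mul_of_mem_Icc hδ.1 hδ.2 (hible θ hθ)
  have ibφ := integrable_mul_of_mem_Icc hφT (fun y => hφ.1 _) (hible b hb)
  have ibδ := integrable_mul_of_mem_Icc hδ.1 hδ.2 (hible b hb)
  have iφ := integrable_of_mem_Icc (P := Q) hφT (fun y => hφ.1 _)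
  have iδ := integrable_of_mem_Icc (P := Q) hδ.1 hδ.2
  set r := (θ - a) / (b - a) with hr
  have hba : 0 < b - a := sub_pos.2 hab
  have hXr : ∀ t, X t ^ r = Real.exp ((θ - a) * t) := fun t => by
    rw [hX, ← Real.exp_mul, hr]
    congr 1
    field_simp
  have key : ∀ σ : ℝ, 0 ≤ σ * (r * (r - 1)) →
      0 ≤ σ * (∫ y, φ (T y) * Real.exp (θ * T y) ∂P - ∫ y, δ y * Real.exp (θ * T y) ∂P) := by
    intro σ hσ
    have hDk : ∀ y, (φ (T y) - δ y) * (σ * X (T y) ^ r) =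
        σ * (φ (T y) * Real.exp ((θ - a) * T y) - δ y * Real.exp ((θ - a) * T y)) := fun y => by
      rw [hXr]; ring
    have hDX : ∀ y, (φ (T y) - δ y) * X (T y) = φ (T y) * X (T y) - δ y * X (T y) :=
      fun y => by ring
    have := hφ.integral_sub_mul_nonneg (P := Q) (T := T) (D := fun y => φ (T y) - δ y)
      (fun y h => by simpa [h] using (hδ.2 y).2) (fun y h => by simpa [h] using (hδ.2 y).1)
      hXm (fun t => Real.exp_pos _) (iφ.sub iδ) (by simp_rw [hDX]; exact ibφ.sub ibδ)
      (by rw [integral_sub iφ iδ, h0, sub_self])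
      (by simp_rw [hDX]; rw [integral_sub ibφ ibδ]; exact sub_eq_zero.2 h1)
      (convexOn_mul_rpow hσ)
      (fun x hx => ((Real.hasDerivAt_rpow_const (Or.inl hx.ne')).const_mul σ).differentiableAt)
      (by simp_rw [hDk]; exact (iθφ.sub iθδ).const_mul σ)
    simp_rw [hDk] at this
    rwa [integral_const_mul, integral_sub iθφ iθδ, hint, hint (fun y => δ y)] at this
  -- Concavity for `0 ≤ r ≤ 1` corresponds to `σ = -1`, convexity outside `(0, 1)` to `σ = 1`. At `r
  -- = 0` and `r = 1` both apply.
  constructor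
  · intro h
    have r0 : 0 ≤ r := div_nonneg (by linarith [h.1]) hba.le
    have r1 : r ≤ 1 := by rw [hr, div_le_one hba]; linarith [h.2]
    have := key (-1) (by nlinarith)
    linarith
  · intro h
    have : 0 ≤ r * (r - 1) := by
      rcases le_or_gt θ a with h1 | h1
      · have : r ≤ 0 := div_nonpos_of_nonpos_of_nonneg (by linarith) hba.le
        nlinarith
      · have h2 : b ≤ θ := not_lt.1 fun h2 => h ⟨h1, h2⟩
        have : 1 ≤ r := by rw [hr, le_div_iff₀ hba]; linarith
        nlinarith
    have := key 1 (by linarith)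
    linarith

end Domination

/-! ### Compactness of interval tests. -/

lemma IsIntervalTest.exists_ereal_endpoints {φ : ℝ → ℝ} (hφ : IsIntervalTest φ) :
    ∃ l u : EReal, ∀ x : ℝ, ((x : EReal) < l → φ x = 1) ∧ (u < (x : EReal) → φ x = 1) ∧
      (l < (x : EReal) → (x : EReal) < u → φ x = 0) := by
  refine ⟨sInf (Real.toEReal '' {x | φ x < 1}), sSup (Real.toEReal '' {x | φ x < 1}),
    fun x => ⟨fun h => ?_, fun h => ?_, fun h1 h2 => ?_⟩⟩
  · by_contra hx
    exact absurd (sInf_le (mem_image_of_mem Real.toEReal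
      (show x ∈ {x | φ x < 1} from lt_of_le_of_ne (hφ.1 x).2 hx))) (not_le.2 h)
  · by_contra hx
    exact absurd (le_sSup (mem_image_of_mem Real.toEReal
      (show x ∈ {x | φ x < 1} from lt_of_le_of_ne (hφ.1 x).2 hx))) (not_le.2 h)
  · obtain ⟨_, ⟨v, hv, rfl⟩, hvx⟩ := sInf_lt_iff.1 h1
    obtain ⟨_, ⟨w, hw, rfl⟩, hxw⟩ := lt_sSup_iff.1 h2
    exact hφ.2 v x w (EReal.coe_lt_coe_iff.1 hvx) (EReal.coe_lt_coe_iff.1 hxw) hv hw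

/-- Pointwise limits of interval tests are interval tests. -/
lemma IsIntervalTest.of_tendsto {φ : ℕ → ℝ → ℝ} {ψ : ℝ → ℝ} (hφ : ∀ n, IsIntervalTest (φ n))
    (hψ : ∀ x, Tendsto (fun n => φ n x) atTop (𝓝 (ψ x))) : IsIntervalTest ψ := by
  refine ⟨fun x => isClosed_Icc.mem_of_tendsto (hψ x) (Eventually.of_forall fun n => (hφ n).1 x),
    fun x y z hxy hyz hx hz => ?_⟩
  refine tendsto_nhds_unique (hψ y) (tendsto_const_nhds.congr' ?_)
  filter_upwards [(hψ x).eventually (gt_mem_nhds hx), (hψ z).eventually (gt_mem_nhds hz)]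
    with n hn1 hn2 using ((hφ n).2 x y z hxy hyz hn1 hn2).symm

/-- Sequential compactness of the set of interval tests for pointwise convergence. -/
lemma exists_subseq_tendsto_isIntervalTest {φ : ℕ → ℝ → ℝ} (hφ : ∀ n, IsIntervalTest (φ n)) :
    ∃ (ψ : ℝ → ℝ) (ns : ℕ → ℕ), StrictMono ns ∧ IsIntervalTest ψ ∧
      ∀ x, Tendsto (fun n => φ (ns n) x) atTop (𝓝 (ψ x)) := by
  choose l u h using fun n => (hφ n).exists_ereal_endpoints
  obtain ⟨⟨l', u'⟩, n₁, hn₁, hlu⟩ := CompactSpace.tendsto_subseq fun n => (l n, u n)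
  have hl : Tendsto (fun n => l (n₁ n)) atTop (𝓝 l') := (Prod.tendsto_iff _ _).1 hlu |>.1
  have hu : Tendsto (fun n => u (n₁ n)) atTop (𝓝 u') := (Prod.tendsto_iff _ _).1 hlu |>.2
  -- Convergence of the endpoints decides the limit everywhere except at the limiting endpoints,
  -- whose values need a further subsequence. For an infinite endpoint `toReal` gives `0`, which is
  -- harmless because that value is never used.
  obtain ⟨⟨v, w⟩, -, n₂, hn₂, hvw⟩ :=
    (isCompact_Icc (a := ((0 : ℝ), (0 : ℝ))) (b := (1, 1))).tendsto_subseq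
      (x := fun n => (φ (n₁ n) l'.toReal, φ (n₁ n) u'.toReal)) fun n =>
      ⟨⟨((hφ _).1 _).1, ((hφ _).1 _).1⟩, ((hφ _).1 _).2, ((hφ _).1 _).2⟩
  have hv := ((Prod.tendsto_iff _ _).1 hvw).1
  have hw := ((Prod.tendsto_iff _ _).1 hvw).2
  have hl' := hl.comp hn₂.tendsto_atTop
  have hu' := hu.comp hn₂.tendsto_atTop
  have hlim : ∀ x : ℝ, ∃ c, Tendsto (fun n => φ (n₁ (n₂ n)) x) atTop (𝓝 c) := by
    intro x
    rcases lt_trichotomy (x : EReal) l' with hx | hx | hx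
    · refine ⟨1, tendsto_const_nhds.congr' ?_⟩
      filter_upwards [hl'.eventually (lt_mem_nhds hx)] with n hn using ((h _ x).1 hn).symm
    · refine ⟨v, ?_⟩
      have : l'.toReal = x := by rw [← hx, EReal.toReal_coe]
      simpa only [this, Function.comp_def] using hv
    rcases lt_trichotomy (x : EReal) u' with hx' | hx' | hx'
    · refine ⟨0, tendsto_const_nhds.congr' ?_⟩
      filter_upwards [hl'.eventually (gt_mem_nhds hx), hu'.eventually (lt_mem_nhds hx')]
        with n hn hn' using ((h _ x).2.2 hn hn').symm
    · refine ⟨w, ?_⟩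
      have : u'.toReal = x := by rw [← hx', EReal.toReal_coe]
      simpa only [this, Function.comp_def] using hw
    · refine ⟨1, tendsto_const_nhds.congr' ?_⟩
      filter_upwards [hu'.eventually (gt_mem_nhds hx')] with n hn using ((h _ x).2.1 hn).symm
  choose ψ hψ using hlim
  exact ⟨ψ, fun n => n₁ (n₂ n), hn₁.comp hn₂, .of_tendsto (fun n => hφ _) hψ, hψ⟩

/-! ### Domination when `Θ₀` may be a single point. -/

section Domination

variable {Y : Type*} [MeasurableSpace Y] {P : Measure Y}

lemma tendsto_integral_mul_of_mem_Icc {φ : ℕ → Y → ℝ} {ψ w : Y → ℝ} (hφ : ∀ n, Measurable (φ n))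
    (hφ01 : ∀ n y, φ n y ∈ Icc (0 : ℝ) 1) (hψ : ∀ y, Tendsto (fun n => φ n y) atTop (𝓝 (ψ y)))
    (hw : Integrable w P) :
    Tendsto (fun n => ∫ y, φ n y * w y ∂P) atTop (𝓝 (∫ y, ψ y * w y ∂P)) := by
  refine tendsto_integral_of_dominated_convergence (fun y => |w y|)
    (fun n => (hφ n).aestronglyMeasurable.mul hw.aestronglyMeasurable) hw.abs
    (fun n => Eventually.of_forall fun y => ?_)
    (Eventually.of_forall fun y => (hψ y).mul tendsto_const_nhds)
  rw [Real.norm_eq_abs, abs_mul, abs_of_nonneg (hφ01 n y).1]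
  exact mul_le_of_le_one_left (abs_nonneg _) (hφ01 n y).2

/-- The point `b'` provides room to the right of `b`: if `a = b`, the test is a limit of tests
dominating on intervals `[a, v n]` with `v n` decreasing to `a`. -/
lemma exists_isIntervalTest_dominating {T : Y → ℝ} (hT : Measurable T) {a b b' : ℝ}
    (hab : a ≤ b) (hbb : b < b')
    (hi : ∀ θ ∈ Icc a b', Integrable (fun y => Real.exp (θ * T y)) P)
    {δ : Y → ℝ} (hδ : IsDecisionRule δ) :
    ∃ φ : ℝ → ℝ, IsIntervalTest φ ∧ Measurable φ ∧
      ∀ θ, Integrable (fun y => Real.exp (θ * T y)) P →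
        (θ ∈ Icc a b →
          ∫ y, φ (T y) * Real.exp (θ * T y) ∂P ≤ ∫ y, δ y * Real.exp (θ * T y) ∂P) ∧
        (θ ∉ Ioo a b →
          ∫ y, δ y * Real.exp (θ * T y) ∂P ≤ ∫ y, φ (T y) * Real.exp (θ * T y) ∂P) := by
  rcases hab.eq_or_lt with rfl | hlt
  · obtain ⟨v, hv, hva, hvt⟩ := exists_seq_strictAnti_tendsto' hbb
    choose φ hφ hφm hdom using fun n => exists_isIntervalTest_dominating_of_lt (P := P) hT
      (hva n).1 (hi a ⟨le_rfl, hbb.le⟩) (hi (v n) ⟨(hva n).1.le, (hva n).2.le⟩) hδ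
    obtain ⟨ψ, ns, hns, hψ, hlim⟩ := exists_subseq_tendsto_isIntervalTest hφ
    refine ⟨ψ, hψ, measurable_of_tendsto_metrizable (fun n => hφm (ns n))
      (tendsto_pi_nhds.2 hlim), fun θ hθ => ?_⟩
    have htend := tendsto_integral_mul_of_mem_Icc (P := P) (φ := fun n y => φ (ns n) (T y))
      (fun n => (hφm (ns n)).comp hT) (fun n y => (hφ (ns n)).1 _) (fun y => hlim (T y)) hθ
    refine ⟨fun h => le_of_tendsto htend (Eventually.of_forall fun n =>
      (hdom (ns n) θ hθ).1 ⟨h.1, h.2.trans (hva _).1.le⟩), fun _ => ge_of_tendsto htend ?_⟩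
    rcases le_or_gt θ a with h | h
    · exact Eventually.of_forall fun n => (hdom (ns n) θ hθ).2 fun hm => absurd hm.1 (not_lt.2 h)
    -- A fixed `θ > a` lies outside the shrinking intervals eventually.
    · filter_upwards [(hvt.comp hns.tendsto_atTop).eventually (gt_mem_nhds h)] with n hn
      exact (hdom (ns n) θ hθ).2 fun hm => absurd hm.2 (not_lt.2 (le_of_lt hn))
  · exact exists_isIntervalTest_dominating_of_lt hT hlt (hi a ⟨le_rfl, hab.trans hbb.le⟩)
      (hi b ⟨hab, hbb.le⟩) hδ

end Domination

/-! ### Integrals of `g` composed with power functions. -/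

section Objective

variable {Λ : Measure ℝ} {g : ℝ → ℝ}

lemma aestronglyMeasurable_comp_of_continuousOn (hg : ContinuousOn g (Icc 0 1)) {p : ℝ → ℝ}
    (hp : Measurable p) (hp01 : ∀ᵐ θ ∂Λ, p θ ∈ Icc (0 : ℝ) 1) :
    AEStronglyMeasurable (fun θ => g (p θ)) Λ := by
  -- Nothing is known about `g` off `[0, 1]`, so measurability comes from its continuous constant
  -- extension.
  have hc : Continuous (IccExtend zero_le_one ((Icc (0 : ℝ) 1).domRestrict g)) :=
    (continuousOn_iff_continuous_domRestrict.1 hg).Icc_extend'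
  refine (hc.measurable.comp hp).aestronglyMeasurable.congr ?_
  filter_upwards [hp01] with θ hθ
  exact IccExtend_of_mem _ _ hθ

lemma integrable_comp_of_continuousOn [IsFiniteMeasure Λ] (hg : ContinuousOn g (Icc 0 1))
    {p : ℝ → ℝ} (hp : Measurable p) (hp01 : ∀ᵐ θ ∂Λ, p θ ∈ Icc (0 : ℝ) 1) :
    Integrable (fun θ => g (p θ)) Λ := by
  obtain ⟨C, hC⟩ := isCompact_Icc.exists_bound_of_continuousOn hg
  exact Integrable.of_bound (aestronglyMeasurable_comp_of_continuousOn hg hp hp01) C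
    (hp01.mono fun θ hθ => hC _ hθ)

lemma tendsto_integral_comp_of_continuousOn [IsFiniteMeasure Λ] (hg : ContinuousOn g (Icc 0 1))
    {p : ℕ → ℝ → ℝ} {q : ℝ → ℝ} (hp : ∀ n, Measurable (p n))
    (hp01 : ∀ᵐ θ ∂Λ, ∀ n, p n θ ∈ Icc (0 : ℝ) 1)
    (hpq : ∀ᵐ θ ∂Λ, Tendsto (fun n => p n θ) atTop (𝓝 (q θ))) :
    Tendsto (fun n => ∫ θ, g (p n θ) ∂Λ) atTop (𝓝 (∫ θ, g (q θ) ∂Λ)) := by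
  obtain ⟨C, hC⟩ := isCompact_Icc.exists_bound_of_continuousOn hg
  refine tendsto_integral_of_dominated_convergence (fun _ => C)
    (fun n => aestronglyMeasurable_comp_of_continuousOn hg (hp n) (hp01.mono fun θ h => h n))
    (integrable_const _) (fun n => hp01.mono fun θ h => hC _ (h n)) ?_
  filter_upwards [hp01, hpq] with θ h1 h2
  have hq : q θ ∈ Icc (0 : ℝ) 1 := isClosed_Icc.mem_of_tendsto h2 (Eventually.of_forall h1)
  exact (hg (q θ) hq).tendsto.comp (tendsto_nhdsWithin_iff.2 ⟨h2, Eventually.of_forall h1⟩)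

end Objective

/-! ### Power functions in the exponential family. -/

section ExponentialFamily

variable {Y : Type*} [MeasurableSpace Y] {μ : Measure Y} {h T : Y → ℝ}

lemma power_expDensity_eq (hh : Measurable h) (hh0 : ∀ y, 0 ≤ h y) (δ : Y → ℝ) (θ : ℝ) :
    power μ (expDensity μ h T) δ θ =
      (∫ y, Real.exp (θ * T y) ∂(μ.withDensity fun y => ENNReal.ofReal (h y)))⁻¹ *
        ∫ y, δ y * Real.exp (θ * T y) ∂(μ.withDensity fun y => ENNReal.ofReal (h y)) := by
  rw [integral_withDensity_ofReal hh hh0, integral_withDensity_ofReal hh hh0, power,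
    ← integral_const_mul]
  simp_rw [expDensity, mul_comm (h _)]
  congr 1; ext y; ring

lemma mem_expDomain_iff (hh : Measurable h) (hh0 : ∀ y, 0 ≤ h y) {θ : ℝ} :
    θ ∈ expDomain μ h T ↔
      Integrable (fun y => Real.exp (θ * T y)) (μ.withDensity fun y => ENNReal.ofReal (h y)) := by
  rw [integrable_withDensity_ofReal hh hh0]
  simp_rw [mul_comm _ (h _)]
  rfl

lemma withDensity_ofReal_ne_zero (hh : Measurable h) (hh0 : ∀ y, 0 ≤ h y) (hne : ¬ h =ᵐ[μ] 0) :
    (μ.withDensity fun y => ENNReal.ofReal (h y)) ≠ 0 := by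
  rw [Ne, withDensity_eq_zero_iff hh.ennreal_ofReal.aemeasurable]
  intro h0
  refine hne (h0.mono fun y hy => ?_)
  have : ENNReal.ofReal (h y) = 0 := hy
  exact le_antisymm (ENNReal.ofReal_eq_zero.1 this) (hh0 y)

lemma integral_exp_mul_pos (hh : Measurable h) (hh0 : ∀ y, 0 ≤ h y) (hne : ¬ h =ᵐ[μ] 0) {θ : ℝ}
    (hθ : θ ∈ expDomain μ h T) :
    0 < ∫ y, Real.exp (θ * T y) ∂(μ.withDensity fun y => ENNReal.ofReal (h y)) := by
  have : NeZero (μ.withDensity fun y => ENNReal.ofReal (h y)) :=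
    ⟨withDensity_ofReal_ne_zero hh hh0 hne⟩
  exact integral_exp_pos ((mem_expDomain_iff hh hh0).1 hθ)

lemma power_mono (hh : Measurable h) (hh0 : ∀ y, 0 ≤ h y) {δ δ' : Y → ℝ} {θ : ℝ}
    (hle : ∫ y, δ y * Real.exp (θ * T y) ∂(μ.withDensity fun y => ENNReal.ofReal (h y)) ≤
      ∫ y, δ' y * Real.exp (θ * T y) ∂(μ.withDensity fun y => ENNReal.ofReal (h y))) :
    power μ (expDensity μ h T) δ θ ≤ power μ (expDensity μ h T) δ' θ := by
  rw [power_expDensity_eq hh hh0, power_expDensity_eq hh hh0]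
  exact mul_le_mul_of_nonneg_left hle (inv_nonneg.2 (integral_nonneg fun y => (Real.exp_pos _).le))

lemma power_mem_Icc (hh : Measurable h) (hh0 : ∀ y, 0 ≤ h y) (hne : ¬ h =ᵐ[μ] 0)
    {δ : Y → ℝ} (hδ : IsDecisionRule δ) {θ : ℝ} (hθ : θ ∈ expDomain μ h T) :
    power μ (expDensity μ h T) δ θ ∈ Icc (0 : ℝ) 1 := by
  have hZ := integral_exp_mul_pos hh hh0 hne hθ
  have hi := (mem_expDomain_iff hh hh0).1 hθ
  rw [power_expDensity_eq hh hh0]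
  refine ⟨mul_nonneg (inv_nonneg.2 hZ.le) (integral_nonneg fun y =>
    mul_nonneg (hδ.2 y).1 (Real.exp_pos _).le), ?_⟩
  rw [inv_mul_le_iff₀ hZ, mul_one]
  exact integral_mono (integrable_mul_of_mem_Icc hδ.1 hδ.2 hi) hi fun y =>
    mul_le_of_le_one_left (Real.exp_pos _).le (hδ.2 y).2

lemma measurable_power [SigmaFinite μ] (hh : Measurable h) (hh0 : ∀ y, 0 ≤ h y)
    (hT : Measurable T) {δ : Y → ℝ} (hδ : Measurable δ) :
    Measurable (power μ (expDensity μ h T) δ) := by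
  have hfun : power μ (expDensity μ h T) δ = fun θ =>
      (∫ y, Real.exp (θ * T y) ∂(μ.withDensity fun y => ENNReal.ofReal (h y)))⁻¹ *
        ∫ y, δ y * Real.exp (θ * T y) ∂(μ.withDensity fun y => ENNReal.ofReal (h y)) :=
    funext fun θ => power_expDensity_eq hh hh0 δ θ
  rw [hfun]
  have h1 : StronglyMeasurable fun q : ℝ × Y => Real.exp (q.1 * T q.2) :=
    Measurable.stronglyMeasurable (by fun_prop)
  have h2 : StronglyMeasurable fun q : ℝ × Y => δ q.2 * Real.exp (q.1 * T q.2) :=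
    Measurable.stronglyMeasurable (by fun_prop)
  exact h1.integral_prod_right.measurable.inv.mul h2.integral_prod_right.measurable

lemma tendsto_power (hh : Measurable h) (hh0 : ∀ y, 0 ≤ h y)
    {φ : ℕ → Y → ℝ} {ψ : Y → ℝ} (hφ : ∀ n, IsDecisionRule (φ n))
    (hψ : ∀ y, Tendsto (fun n => φ n y) atTop (𝓝 (ψ y))) {θ : ℝ} (hθ : θ ∈ expDomain μ h T) :
    Tendsto (fun n => power μ (expDensity μ h T) (φ n) θ) atTop
      (𝓝 (power μ (expDensity μ h T) ψ θ)) := by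
  simp_rw [power_expDensity_eq hh hh0]
  exact (tendsto_integral_mul_of_mem_Icc (fun n => (hφ n).1) (fun n => (hφ n).2) hψ
    ((mem_expDomain_iff hh hh0).1 hθ)).const_mul _

/-- Mixing a rule with certain rejection. -/
lemma power_mix (hh : Measurable h) (hh0 : ∀ y, 0 ≤ h y) (hne : ¬ h =ᵐ[μ] 0)
    {δ : Y → ℝ} (hδ : IsDecisionRule δ) {θ : ℝ} (hθ : θ ∈ expDomain μ h T) (ε : ℝ) :
    power μ (expDensity μ h T) (fun y => δ y + ε * (1 - δ y)) θ =
      power μ (expDensity μ h T) δ θ + ε * (1 - power μ (expDensity μ h T) δ θ) := by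
  have hZ := integral_exp_mul_pos hh hh0 hne hθ
  have hi := (mem_expDomain_iff hh hh0).1 hθ
  have hδi := integrable_mul_of_mem_Icc hδ.1 hδ.2 hi
  rw [power_expDensity_eq hh hh0, power_expDensity_eq hh hh0]
  have : ∀ y, (δ y + ε * (1 - δ y)) * Real.exp (θ * T y) =
      (1 - ε) * (δ y * Real.exp (θ * T y)) + ε * Real.exp (θ * T y) := fun y => by ring
  simp_rw [this]
  rw [integral_add (hδi.const_mul _) (hi.const_mul _), integral_const_mul, integral_const_mul]
  field_simp
  ring

/-- The densities `exp (θ * T)` are strictly positive, so the conclusion no longer depends on `θ`;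
this carries certain rejection from a point of `Θ₁` over to `Θ₀`. -/
lemma ae_eq_one_of_power_eq_one (hh : Measurable h) (hh0 : ∀ y, 0 ≤ h y) (hne : ¬ h =ᵐ[μ] 0)
    {δ : Y → ℝ} (hδ : IsDecisionRule δ) {θ : ℝ} (hθ : θ ∈ expDomain μ h T)
    (h1 : power μ (expDensity μ h T) δ θ = 1) :
    ∀ᵐ y ∂(μ.withDensity fun y => ENNReal.ofReal (h y)), δ y = 1 := by
  have hZ := integral_exp_mul_pos hh hh0 hne hθ
  have hi := (mem_expDomain_iff hh hh0).1 hθ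
  have hδi := integrable_mul_of_mem_Icc hδ.1 hδ.2 hi
  rw [power_expDensity_eq hh hh0, inv_mul_eq_iff_eq_mul₀ hZ.ne', mul_one] at h1
  have h0 : ∫ y, (Real.exp (θ * T y) - δ y * Real.exp (θ * T y))
      ∂(μ.withDensity fun y => ENNReal.ofReal (h y)) = 0 := by
    rw [integral_sub hi hδi, h1, sub_self]
  have := (integral_eq_zero_iff_of_nonneg (fun y => sub_nonneg.2
    (mul_le_of_le_one_left (Real.exp_pos _).le (hδ.2 y).2)) (hi.sub hδi)).1 h0
  filter_upwards [this] with y hy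
  have hy' : Real.exp (θ * T y) - δ y * Real.exp (θ * T y) = 0 := hy
  have : (1 - δ y) * Real.exp (θ * T y) = 0 := by linarith
  rcases mul_eq_zero.1 this with h | h
  · linarith
  · exact absurd h (Real.exp_pos _).ne'

lemma power_congr_ae (hh : Measurable h) (hh0 : ∀ y, 0 ≤ h y) {δ δ' : Y → ℝ}
    (hae : ∀ᵐ y ∂(μ.withDensity fun y => ENNReal.ofReal (h y)), δ y = δ' y) :
    power μ (expDensity μ h T) δ = power μ (expDensity μ h T) δ' := by
  ext θ
  rw [power_expDensity_eq hh hh0, power_expDensity_eq hh hh0]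
  congr 1
  refine integral_congr_ae ?_
  filter_upwards [hae] with y hy
  rw [hy]

lemma power_one (hh : Measurable h) (hh0 : ∀ y, 0 ≤ h y) (hne : ¬ h =ᵐ[μ] 0) {θ : ℝ}
    (hθ : θ ∈ expDomain μ h T) : power μ (expDensity μ h T) (fun _ => 1) θ = 1 := by
  rw [power_expDensity_eq hh hh0]
  simp_rw [one_mul]
  exact inv_mul_cancel₀ (integral_exp_mul_pos hh hh0 hne hθ).ne'

end ExponentialFamily

/-! ### Existence, size and form of an optimal rule. -/

section Optimality

variable {Y : Type*} [MeasurableSpace Y] {μ : Measure Y} {h T : Y → ℝ} {g : ℝ → ℝ}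
  {Θ : Set ℝ} {Λ : Measure ℝ}

lemma integrableOn_comp_power [SigmaFinite μ] [IsFiniteMeasure Λ] (hh : Measurable h)
    (hh0 : ∀ y, 0 ≤ h y) (hne : ¬ h =ᵐ[μ] 0) (hT : Measurable T) (hΘ : MeasurableSet Θ)
    (hΘd : Θ ⊆ expDomain μ h T) (hg : ContinuousOn g (Icc 0 1)) {δ : Y → ℝ}
    (hδ : IsDecisionRule δ) :
    Integrable (fun θ => g (power μ (expDensity μ h T) δ θ)) (Λ.restrict Θ) :=
  integrable_comp_of_continuousOn hg (measurable_power hh hh0 hT hδ.1)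
    ((ae_restrict_mem hΘ).mono fun _ hθ => power_mem_Icc hh hh0 hne hδ (hΘd hθ))

lemma tendsto_objective [SigmaFinite μ] [IsFiniteMeasure Λ] (hh : Measurable h)
    (hh0 : ∀ y, 0 ≤ h y) (hne : ¬ h =ᵐ[μ] 0) (hT : Measurable T) (hΘ : MeasurableSet Θ)
    (hΘd : Θ ⊆ expDomain μ h T) (hg : ContinuousOn g (Icc 0 1)) {φ : ℕ → Y → ℝ} {ψ : Y → ℝ}
    (hφ : ∀ n, IsDecisionRule (φ n)) (hψ : ∀ y, Tendsto (fun n => φ n y) atTop (𝓝 (ψ y))) :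
    Tendsto (fun n => objective μ (expDensity μ h T) g Θ Λ (φ n)) atTop
      (𝓝 (objective μ (expDensity μ h T) g Θ Λ ψ)) :=
  tendsto_integral_comp_of_continuousOn hg (fun n => measurable_power hh hh0 hT (hφ n).1)
    ((ae_restrict_mem hΘ).mono fun _ hθ n => power_mem_Icc hh hh0 hne (hφ n) (hΘd hθ))
    ((ae_restrict_mem hΘ).mono fun _ hθ => tendsto_power hh hh0 hφ hψ (hΘd hθ))

lemma objective_mono [SigmaFinite μ] [IsFiniteMeasure Λ] (hh : Measurable h)
    (hh0 : ∀ y, 0 ≤ h y) (hne : ¬ h =ᵐ[μ] 0) (hT : Measurable T) (hΘ : MeasurableSet Θ)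
    (hΘd : Θ ⊆ expDomain μ h T) (hg : ContinuousOn g (Icc 0 1)) (hgm : MonotoneOn g (Icc 0 1))
    {δ δ' : Y → ℝ} (hδ : IsDecisionRule δ) (hδ' : IsDecisionRule δ')
    (hle : ∀ θ ∈ Θ, power μ (expDensity μ h T) δ θ ≤ power μ (expDensity μ h T) δ' θ) :
    objective μ (expDensity μ h T) g Θ Λ δ ≤ objective μ (expDensity μ h T) g Θ Λ δ' := by
  refine setIntegral_mono_on (integrableOn_comp_power hh hh0 hne hT hΘ hΘd hg hδ)
    (integrableOn_comp_power hh hh0 hne hT hΘ hΘd hg hδ') hΘ fun θ hθ => ?_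
  exact hgm (power_mem_Icc hh hh0 hne hδ (hΘd hθ)) (power_mem_Icc hh hh0 hne hδ' (hΘd hθ))
    (hle θ hθ)

lemma objective_strictMono [SigmaFinite μ] [IsProbabilityMeasure Λ] (hh : Measurable h)
    (hh0 : ∀ y, 0 ≤ h y) (hne : ¬ h =ᵐ[μ] 0) (hT : Measurable T) (hΘ : MeasurableSet Θ)
    (hΘd : Θ ⊆ expDomain μ h T) (hΛ : Λ Θᶜ = 0) (hg : ContinuousOn g (Icc 0 1))
    (hgm : StrictMonoOn g (Icc 0 1)) {δ δ' : Y → ℝ} (hδ : IsDecisionRule δ)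
    (hδ' : IsDecisionRule δ')
    (hlt : ∀ θ ∈ Θ, power μ (expDensity μ h T) δ θ < power μ (expDensity μ h T) δ' θ) :
    objective μ (expDensity μ h T) g Θ Λ δ < objective μ (expDensity μ h T) g Θ Λ δ' := by
  have i1 := integrableOn_comp_power (Λ := Λ) hh hh0 hne hT hΘ hΘd hg hδ
  have i2 := integrableOn_comp_power (Λ := Λ) hh hh0 hne hT hΘ hΘd hg hδ'
  have hpos : ∀ θ ∈ Θ, 0 < g (power μ (expDensity μ h T) δ' θ) -
      g (power μ (expDensity μ h T) δ θ) := fun θ hθ => sub_pos.2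
    (hgm (power_mem_Icc hh hh0 hne hδ (hΘd hθ)) (power_mem_Icc hh hh0 hne hδ' (hΘd hθ))
      (hlt θ hθ))
  have hΛΘ : 0 < Λ Θ := by
    have := prob_compl_eq_zero_iff (μ := Λ) hΘ |>.1 hΛ
    simp [this]
  rw [← sub_pos, objective, objective, ← integral_sub i2 i1]
  rw [integral_pos_iff_support_of_nonneg_ae ((ae_restrict_mem hΘ).mono fun θ hθ =>
    (hpos θ hθ).le) (i2.sub i1), Measure.restrict_apply' hΘ]
  refine hΛΘ.trans_le (measure_mono fun θ hθ => ⟨(hpos θ hθ).ne', hθ⟩)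

lemma IsIntervalTest.isDecisionRule {φ : ℝ → ℝ} (hφ : IsIntervalTest φ) (hφm : Measurable φ)
    (hT : Measurable T) : IsDecisionRule fun y => φ (T y) :=
  ⟨hφm.comp hT, fun _ => hφ.1 _⟩

variable {a b K α : ℝ} {Λ₀ Λ₁ : Measure ℝ}

/-- Every decision rule is dominated by an interval test, in terms of average size and
objective. -/
lemma exists_isIntervalTest_objective_ge [SigmaFinite μ] [IsFiniteMeasure Λ₀] [IsFiniteMeasure Λ₁]
    (hh : Measurable h) (hh0 : ∀ y, 0 ≤ h y) (hne : ¬ h =ᵐ[μ] 0) (hT : Measurable T)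
    (hab : a ≤ b) (hK : max |a| |b| < K) (hdom : Icc (-K) K ⊆ expDomain μ h T)
    (hg : ContinuousOn g (Icc 0 1)) (hgm : MonotoneOn g (Icc 0 1)) {δ : Y → ℝ}
    (hδ : IsDecisionRule δ) :
    ∃ φ : ℝ → ℝ, IsIntervalTest φ ∧ Measurable φ ∧
      averageSize μ (expDensity μ h T) (Icc a b) Λ₀ (fun y => φ (T y)) ≤
        averageSize μ (expDensity μ h T) (Icc a b) Λ₀ δ ∧
      objective μ (expDensity μ h T) g (Icc (-K) K \ Icc a b) Λ₁ δ ≤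
        objective μ (expDensity μ h T) g (Icc (-K) K \ Icc a b) Λ₁ fun y => φ (T y) := by
  have ha : -K < a := (abs_lt.1 ((le_max_left _ _).trans_lt hK)).1
  have hb : b < K := (abs_lt.1 ((le_max_right _ _).trans_lt hK)).2
  obtain ⟨φ, hφ, hφm, hd⟩ := exists_isIntervalTest_dominating hT hab hb
    (P := μ.withDensity fun y => ENNReal.ofReal (h y))
    (fun θ hθ => (mem_expDomain_iff hh hh0).1 (hdom ⟨ha.le.trans hθ.1, hθ.2⟩)) hδ
  have hφd := hφ.isDecisionRule hφm hT
  have hsub : Icc a b ⊆ expDomain μ h T := (Icc_subset_Icc ha.le hb.le).trans hdom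
  refine ⟨φ, hφ, hφm, ?_, ?_⟩
  -- The average size is the objective for the identity in place of `g`.
  · refine objective_mono hh hh0 hne hT measurableSet_Icc hsub continuousOn_id
      monotoneOn_id hφd hδ fun θ hθ => power_mono hh hh0 ?_
    exact (hd θ ((mem_expDomain_iff hh hh0).1 (hsub hθ))).1 hθ
  · refine objective_mono hh hh0 hne hT (measurableSet_Icc.diff measurableSet_Icc)
      (sdiff_subset.trans hdom) hg hgm hδ hφd fun θ hθ => power_mono hh hh0 ?_
    exact (hd θ ((mem_expDomain_iff hh hh0).1 (hdom hθ.1))).2 fun hm =>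
      hθ.2 (Ioo_subset_Icc_self hm)

/-- By domination the supremum may be taken over feasible interval tests. A maximizing sequence has
a pointwise convergent subsequence, along which size and objective converge. -/
lemma exists_isIntervalTest_isOptimalRule [SigmaFinite μ] [IsFiniteMeasure Λ₀]
    [IsFiniteMeasure Λ₁] (hh : Measurable h) (hh0 : ∀ y, 0 ≤ h y) (hne : ¬ h =ᵐ[μ] 0)
    (hT : Measurable T) (hab : a ≤ b) (hK : max |a| |b| < K)
    (hdom : Icc (-K) K ⊆ expDomain μ h T) (hg : ContinuousOn g (Icc 0 1))
    (hgm : MonotoneOn g (Icc 0 1)) (hα : 0 ≤ α) :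
    ∃ φ : ℝ → ℝ, IsIntervalTest φ ∧ Measurable φ ∧
      IsOptimalRule μ (expDensity μ h T) g (Icc a b) (Icc (-K) K \ Icc a b) Λ₀ Λ₁ α
        fun y => φ (T y) := by
  have ha : -K < a := (abs_lt.1 ((le_max_left _ _).trans_lt hK)).1
  have hb : b < K := (abs_lt.1 ((le_max_right _ _).trans_lt hK)).2
  have hsub : Icc a b ⊆ expDomain μ h T := (Icc_subset_Icc ha.le hb.le).trans hdom
  have hΘ₁ : MeasurableSet (Icc (-K) K \ Icc a b) := measurableSet_Icc.diff measurableSet_Icc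
  have hsub₁ : Icc (-K) K \ Icc a b ⊆ expDomain μ h T := sdiff_subset.trans hdom
  set f := expDensity μ h T with hf
  set obj := objective μ f g (Icc (-K) K \ Icc a b) Λ₁ with hobj
  set S : Set ℝ := {v | ∃ φ : ℝ → ℝ, IsIntervalTest φ ∧ Measurable φ ∧
    averageSize μ f (Icc a b) Λ₀ (fun y => φ (T y)) ≤ α ∧ obj (fun y => φ (T y)) = v} with hS
  have hdomin : ∀ δ, IsFeasible μ f (Icc a b) Λ₀ α δ → ∃ v ∈ S, obj δ ≤ v := by
    intro δ hδ
    obtain ⟨φ, hφ, hφm, h1, h2⟩ := exists_isIntervalTest_objective_ge (Λ₀ := Λ₀) (Λ₁ := Λ₁)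
      hh hh0 hne hT hab hK hdom hg hgm hδ.1
    exact ⟨_, ⟨φ, hφ, hφm, h1.trans hδ.2, rfl⟩, h2⟩
  have hSne : S.Nonempty := by
    obtain ⟨v, hv, -⟩ := hdomin (fun _ => 0) ⟨⟨measurable_const, fun _ => by simp⟩, by
      simpa [averageSize, power] using hα⟩
    exact ⟨v, hv⟩
  have hSb : BddAbove S := by
    refine ⟨obj fun _ => 1, ?_⟩
    rintro _ ⟨φ, hφ, hφm, -, rfl⟩
    have h1 : IsDecisionRule fun _ : Y => (1 : ℝ) := ⟨measurable_const, fun _ => by simp⟩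
    refine objective_mono hh hh0 hne hT hΘ₁ hsub₁ hg hgm (hφ.isDecisionRule hφm hT) h1
      fun θ hθ => ?_
    rw [power_one hh hh0 hne (hsub₁ hθ)]
    exact (power_mem_Icc hh hh0 hne (hφ.isDecisionRule hφm hT) (hsub₁ hθ)).2
  obtain ⟨v, -, hvt, hvS⟩ := exists_seq_tendsto_sSup hSne hSb
  choose φ hφ hφm hsize hval using hvS
  obtain ⟨ψ, ns, hns, hψ, hlim⟩ := exists_subseq_tendsto_isIntervalTest hφ
  have hψm : Measurable ψ := measurable_of_tendsto_metrizable (fun n => hφm (ns n))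
    (tendsto_pi_nhds.2 hlim)
  have hdr : ∀ n, IsDecisionRule fun y => φ (ns n) (T y) := fun n =>
    (hφ _).isDecisionRule (hφm _) hT
  refine ⟨ψ, hψ, hψm, ⟨hψ.isDecisionRule hψm hT, ?_⟩, fun δ hδ => ?_⟩
  · exact le_of_tendsto (tendsto_objective (Λ := Λ₀) hh hh0 hne hT measurableSet_Icc hsub
      continuousOn_id hdr fun y => hlim (T y)) (Eventually.of_forall fun n => hsize (ns n))
  · have h1 := tendsto_objective (Λ := Λ₁) hh hh0 hne hT hΘ₁ hsub₁ hg hdr fun y => hlim (T y)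
    have h2 : objective μ (expDensity μ h T) g (Icc (-K) K \ Icc a b) Λ₁ (fun y => ψ (T y)) =
        sSup S := by
      refine tendsto_nhds_unique h1 ((hvt.comp hns.tendsto_atTop).congr fun n => ?_)
      exact (hval (ns n)).symm
    obtain ⟨w, hw, hδw⟩ := hdomin δ hδ
    rw [h2]
    exact hδw.trans (le_csSup hSb hw)

lemma averageSize_eq_one_of_ae [IsProbabilityMeasure Λ] (hh : Measurable h) (hh0 : ∀ y, 0 ≤ h y)
    (hne : ¬ h =ᵐ[μ] 0) (hΘ : MeasurableSet Θ) (hΘd : Θ ⊆ expDomain μ h T) (hΛ : Λ Θᶜ = 0)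
    {δ : Y → ℝ} (hδ : ∀ᵐ y ∂(μ.withDensity fun y => ENNReal.ofReal (h y)), δ y = 1) :
    averageSize μ (expDensity μ h T) Θ Λ δ = 1 := by
  rw [averageSize, power_congr_ae hh hh0 (δ' := fun _ => 1) hδ,
    setIntegral_congr_fun hΘ fun θ hθ => power_one hh hh0 hne (hΘd hθ)]
  simp [Measure.real, prob_compl_eq_zero_iff (μ := Λ) hΘ |>.1 hΛ]

/-- An optimal rule exhausts the admissible average size. -/
lemma IsOptimalRule.averageSize_eq [SigmaFinite μ] [IsProbabilityMeasure Λ₀]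
    [IsProbabilityMeasure Λ₁] (hh : Measurable h) (hh0 : ∀ y, 0 ≤ h y) (hne : ¬ h =ᵐ[μ] 0)
    (hT : Measurable T) {Θ₀ Θ₁ : Set ℝ} (hΘ₀ : MeasurableSet Θ₀) (hΘ₁ : MeasurableSet Θ₁)
    (hd₀ : Θ₀ ⊆ expDomain μ h T) (hd₁ : Θ₁ ⊆ expDomain μ h T) (hΛ₀ : Λ₀ Θ₀ᶜ = 0)
    (hΛ₁ : Λ₁ Θ₁ᶜ = 0) (hα : α < 1) (hg : ContinuousOn g (Icc 0 1))
    (hgm : StrictMonoOn g (Icc 0 1)) {δ : Y → ℝ}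
    (hδ : IsOptimalRule μ (expDensity μ h T) g Θ₀ Θ₁ Λ₀ Λ₁ α δ) :
    averageSize μ (expDensity μ h T) Θ₀ Λ₀ δ = α := by
  by_contra hcon
  have hlt : averageSize μ (expDensity μ h T) Θ₀ Λ₀ δ < α := lt_of_le_of_ne hδ.1.2 hcon
  have hδd := hδ.1.1
  set s := averageSize μ (expDensity μ h T) Θ₀ Λ₀ δ with hs
  have hs0 : 0 ≤ s := setIntegral_nonneg hΘ₀ fun θ hθ =>
    (power_mem_Icc hh hh0 hne hδd (hd₀ hθ)).1
  -- With mixing weight `α - s` the size grows by `(α - s) * (1 - s) ≤ α - s`, so the new rule stays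
  -- feasible.
  have hδ' : IsDecisionRule fun y => δ y + (α - s) * (1 - δ y) := by
    have hm := hδd.1
    refine ⟨by fun_prop, fun y => ?_⟩
    have h1 := hδd.2 y
    have h2 : 0 ≤ 1 - δ y := sub_nonneg.2 h1.2
    constructor
    · nlinarith [h1.1]
    · nlinarith
  have hip : Integrable (power μ (expDensity μ h T) δ) (Λ₀.restrict Θ₀) :=
    integrableOn_comp_power (g := fun t => t) hh hh0 hne hT hΘ₀ hd₀ continuousOn_id hδd
  have hsize : averageSize μ (expDensity μ h T) Θ₀ Λ₀ (fun y => δ y + (α - s) * (1 - δ y)) =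
      s + (α - s) * (1 - s) := by
    rw [averageSize, setIntegral_congr_fun hΘ₀ fun θ hθ => power_mix hh hh0 hne hδd (hd₀ hθ) _,
      integral_add hip ((integrable_fun_sub (integrable_const _) hip).const_mul _),
      integral_const_mul,
      integral_sub (integrable_const _) hip]
    have : ∫ _ in Θ₀, (1 : ℝ) ∂Λ₀ = 1 := by
      simp [Measure.real, prob_compl_eq_zero_iff (μ := Λ₀) hΘ₀ |>.1 hΛ₀]
    rw [this]
    rfl
  refine absurd (hδ.2 _ ⟨hδ', ?_⟩) (not_le.2 ?_)
  · rw [hsize]; nlinarith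
  · refine objective_strictMono hh hh0 hne hT hΘ₁ hd₁ hΛ₁ hg hgm hδd hδ' fun θ hθ => ?_
    rw [power_mix hh hh0 hne hδd (hd₁ hθ)]
    -- Power `1` at one point would make the rule reject almost surely, hence have size `1 > α`.
    have hp : power μ (expDensity μ h T) δ θ < 1 := by
      refine lt_of_le_of_ne (power_mem_Icc hh hh0 hne hδd (hd₁ hθ)).2 fun h1 => ?_
      have := averageSize_eq_one_of_ae hh hh0 hne hΘ₀ hd₀ hΛ₀
        (ae_eq_one_of_power_eq_one hh hh0 hne hδd (hd₁ hθ) h1)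
      linarith
    have := mul_pos (sub_pos.2 hlt) (sub_pos.2 hp)
    linarith

lemma IsOptimalRule.congr_ae (hh : Measurable h) (hh0 : ∀ y, 0 ≤ h y) {Θ₀ Θ₁ : Set ℝ}
    {δ δ' : Y → ℝ} (hδ : IsOptimalRule μ (expDensity μ h T) g Θ₀ Θ₁ Λ₀ Λ₁ α δ)
    (hδ' : IsDecisionRule δ')
    (hae : ∀ᵐ y ∂(μ.withDensity fun y => ENNReal.ofReal (h y)), δ y = δ' y) :
    IsOptimalRule μ (expDensity μ h T) g Θ₀ Θ₁ Λ₀ Λ₁ α δ' := by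
  have hp := power_congr_ae (T := T) hh hh0 hae
  refine ⟨⟨hδ', ?_⟩, fun δ'' h'' => ?_⟩
  · have := hδ.1.2
    rwa [averageSize, hp] at this
  · have := hδ.2 δ'' h''
    rwa [objective, objective, hp] at this

/-- The interval form of a test that accepts at some value of the statistic, where a degenerate
interval is allowed only at an accumulated atom of `ν`, up to modification on a `ν`-null set. -/
lemma IsIntervalTest.exists_ae_eq_form {φ : ℝ → ℝ} (hφ : IsIntervalTest φ) (hφm : Measurable φ)
    {ν : Measure ℝ} (hν : ¬ ∀ᵐ t ∂ν, φ t = 1) :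
    ∃ (ψ : ℝ → ℝ) (l u : EReal), Measurable ψ ∧ (∀ t, ψ t ∈ Icc (0 : ℝ) 1) ∧
      (∀ᵐ t ∂ν, φ t = ψ t) ∧ l ≤ u ∧
      (l = u → ∃ c : ℝ, l = (c : EReal) ∧ IsTwoSidedAccumulatedAtom ν c) ∧
      ∀ t : ℝ, (((t : EReal) < l ∨ u < (t : EReal)) → ψ t = 1) ∧
        ((l < (t : EReal) ∧ (t : EReal) < u) → ψ t = 0) := by
  obtain ⟨x, hx⟩ : ∃ x, φ x < 1 := by
    by_contra! hcon
    exact hν (Eventually.of_forall fun t => le_antisymm (hφ.1 t).2 (hcon t))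
  -- Two distinct points of possible acceptance already force the infimum strictly below the
  -- supremum.
  by_cases hsub : ∃ z, φ z < 1 ∧ z ≠ x
  · set A : Set EReal := Real.toEReal '' {t | φ t < 1} with hA
    have hmem : ∀ {t : ℝ}, φ t < 1 → (t : EReal) ∈ A := fun ht => mem_image_of_mem _ ht
    obtain ⟨z, hz, hzx⟩ := hsub
    have hlu : sInf A < sSup A := by
      rcases lt_or_gt_of_ne hzx with hlt | hlt
      · exact (sInf_le (hmem hz)).trans_lt
          ((EReal.coe_lt_coe_iff.2 hlt).trans_le (le_sSup (hmem hx)))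
      · exact (sInf_le (hmem hx)).trans_lt
          ((EReal.coe_lt_coe_iff.2 hlt).trans_le (le_sSup (hmem hz)))
    refine ⟨φ, sInf A, sSup A, hφm, hφ.1, Eventually.of_forall fun _ => rfl, hlu.le,
      fun h => absurd h hlu.ne, fun t => ⟨fun ht => ?_, fun ht => ?_⟩⟩
    · by_contra h1
      have h1' := lt_of_le_of_ne (hφ.1 t).2 h1
      rcases ht with ht | ht
      · exact absurd (sInf_le (hmem h1')) (not_le.2 ht)
      · exact absurd (le_sSup (hmem h1')) (not_le.2 ht)
    · obtain ⟨_, ⟨v, hv, rfl⟩, hvt⟩ := sInf_lt_iff.1 ht.1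
      obtain ⟨_, ⟨w, hw, rfl⟩, htw⟩ := lt_sSup_iff.1 ht.2
      exact hφ.2 v t w (EReal.coe_lt_coe_iff.1 hvt) (EReal.coe_lt_coe_iff.1 htw) hv hw
  push Not at hsub
  have hone : ∀ t, t ≠ x → φ t = 1 := fun t ht => by
    by_contra h1
    exact ht (hsub t (lt_of_le_of_ne (hφ.1 t).2 h1))
  have hatom : 0 < ν {x} := by
    refine pos_iff_ne_zero.2 fun h0 => hν ?_
    filter_upwards [compl_mem_ae_iff.2 h0] with t ht using hone t ht
  -- Here `x` is the only point of possible acceptance. If a one-sided punctured neighbourhood of it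
  -- is null, accepting there too changes nothing almost everywhere and gives a nondegenerate
  -- interval with `x` as an endpoint.
  have modify : ∀ v w : ℝ, v ≤ x → x ≤ w → v < w → (v = x ∨ w = x) → ν (Ioo v w) = 0 →
      ∃ (ψ : ℝ → ℝ) (l u : EReal), Measurable ψ ∧ (∀ t, ψ t ∈ Icc (0 : ℝ) 1) ∧
      (∀ᵐ t ∂ν, φ t = ψ t) ∧ l ≤ u ∧
      (l = u → ∃ c : ℝ, l = (c : EReal) ∧ IsTwoSidedAccumulatedAtom ν c) ∧
      ∀ t : ℝ, (((t : EReal) < l ∨ u < (t : EReal)) → ψ t = 1) ∧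
        ((l < (t : EReal) ∧ (t : EReal) < u) → ψ t = 0) := by
    intro v w hvx hxw hvw hor h0
    refine ⟨(Ioo v w)ᶜ.indicator φ, v, w, hφm.indicator measurableSet_Ioo.compl, fun t => ?_, ?_,
      EReal.coe_le_coe_iff.2 hvw.le, fun h => absurd (EReal.coe_injective h) hvw.ne,
      fun t => ⟨fun ht => ?_, fun ht => ?_⟩⟩
    · by_cases ht : t ∈ Ioo v w
      · rw [indicator_of_notMem (by simpa using ht)]; simp
      · rw [indicator_of_mem (by simpa using ht)]; exact hφ.1 t
    · filter_upwards [compl_mem_ae_iff.2 h0] with t ht using (indicator_of_mem ht _).symm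
    · rw [EReal.coe_lt_coe_iff, EReal.coe_lt_coe_iff] at ht
      have hmem : t ∈ (Ioo v w)ᶜ := by
        rintro ⟨h1, h2⟩
        rcases ht with ht | ht <;> linarith
      rw [indicator_of_mem hmem]
      refine hone t ?_
      rintro rfl
      rcases ht with ht | ht <;> linarith
    · rw [EReal.coe_lt_coe_iff, EReal.coe_lt_coe_iff] at ht
      exact indicator_of_notMem (by simpa using ht) _
  by_cases hacc : IsTwoSidedAccumulatedAtom ν x
  · refine ⟨φ, x, x, hφm, hφ.1, Eventually.of_forall fun _ => rfl, le_rfl, fun _ => ⟨x, rfl, hacc⟩,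
      fun t => ⟨fun ht => hone t ?_, fun ht => absurd (ht.1.trans ht.2) (lt_irrefl _)⟩⟩
    rintro rfl
    simp at ht
  · simp only [IsTwoSidedAccumulatedAtom, hatom, true_and, not_forall, not_and_or] at hacc
    obtain ⟨ε, hε, hacc⟩ := hacc
    rcases hacc with h0 | h0
    · exact modify (x - ε) x (by linarith) le_rfl (by linarith) (Or.inr rfl)
        (le_antisymm (not_lt.1 h0) zero_le)
    · exact modify x (x + ε) le_rfl (by linarith) (by linarith) (Or.inl rfl)
        (le_antisymm (not_lt.1 h0) zero_le)

end Optimality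

end NPTest

/-! ### Assembly of the theorem. -/

theorem theorem4
    {d : ℕ} (𝕐 : Set (EuclideanSpace ℝ (Fin d)))
    (μ : Measure 𝕐) [SigmaFinite μ]
    -- the exponential family
    (h T : 𝕐 → ℝ) (hh : Measurable h) (hh0 : ∀ y, 0 ≤ h y) (hhne : ¬ h =ᵐ[μ] 0)
    (hT : Measurable T)
    (hopen : IsOpen (NPTest.expDomain μ h T))
    -- the parameter sets `Θ₀ = [a, b]` and `Θ = [-K, K]`
    (a b K : ℝ) (hab : a ≤ b) (hK : max |a| |b| < K)
    (hdom : Icc (-K) K ⊆ NPTest.expDomain μ h T)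
    -- the weighting probability measures on `Θ₀` and `Θ₁ = Θ \ Θ₀`
    (Λ₀ Λ₁ : Measure ℝ) [IsProbabilityMeasure Λ₀] [IsProbabilityMeasure Λ₁]
    (hΛ₀ : Λ₀ (Icc a b)ᶜ = 0) (hΛ₁ : Λ₁ (Icc (-K) K \ Icc a b)ᶜ = 0)
    (α : ℝ) (hα : α ∈ Ioo (0 : ℝ) 1)
    -- the function `g : [0, 1] → ℝ`
    (g : ℝ → ℝ) (hg_cont : ContinuousOn g (Icc 0 1))
    (hg_diff : ∀ t ∈ Ioo (0 : ℝ) 1, DifferentiableAt ℝ g t)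
    (hg_deriv_cont : ContinuousOn (deriv g) (Ioo 0 1))
    (hg_deriv_pos : ∀ t ∈ Ioo (0 : ℝ) 1, 0 < deriv g t) :
    ∃ δ : 𝕐 → ℝ,
      NPTest.IsOptimalRule μ (NPTest.expDensity μ h T) g
        (Icc a b) (Icc (-K) K \ Icc a b) Λ₀ Λ₁ α δ ∧
      NPTest.averageSize μ (NPTest.expDensity μ h T) (Icc a b) Λ₀ δ = α ∧
      ∃ (l u : EReal) (γ : 𝕐 → ℝ),
        l ≤ u ∧
        (l = u → ∃ c : ℝ, l = (c : EReal) ∧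
          NPTest.IsTwoSidedAccumulatedAtom (NPTest.baseLaw μ h T) c) ∧
        Measurable γ ∧ (∀ y, γ y ∈ Icc (0 : ℝ) 1) ∧
        NPTest.IsTwoSidedForm T l u γ δ := by
  have hgm : StrictMonoOn g (Icc 0 1) :=
    strictMonoOn_of_deriv_pos (convex_Icc 0 1) hg_cont (by simpa using hg_deriv_pos)
  have ha : -K < a := (abs_lt.1 ((le_max_left _ _).trans_lt hK)).1
  have hb : b < K := (abs_lt.1 ((le_max_right _ _).trans_lt hK)).2
  have hsub : Icc a b ⊆ NPTest.expDomain μ h T := (Icc_subset_Icc ha.le hb.le).trans hdom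
  obtain ⟨φ, hφ, hφm, hopt⟩ := NPTest.exists_isIntervalTest_isOptimalRule (Λ₀ := Λ₀) (Λ₁ := Λ₁)
    hh hh0 hhne hT hab hK hdom hg_cont hgm.monotoneOn hα.1.le
  have hsize := fun {δ : 𝕐 → ℝ} (hδ : NPTest.IsOptimalRule μ (NPTest.expDensity μ h T) g
      (Icc a b) (Icc (-K) K \ Icc a b) Λ₀ Λ₁ α δ) =>
    hδ.averageSize_eq hh hh0 hhne hT measurableSet_Icc (measurableSet_Icc.diff measurableSet_Icc)
      hsub (sdiff_subset.trans hdom) hΛ₀ hΛ₁ hα.2 hg_cont hgm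
  -- Almost sure rejection would give size `1`, not `α`; so there is something to accept and the
  -- interval form applies.
  have hν : ¬ ∀ᵐ t ∂(NPTest.baseLaw μ h T), φ t = 1 := by
    intro hae
    have := NPTest.averageSize_eq_one_of_ae hh hh0 hhne measurableSet_Icc hsub hΛ₀
      (ae_of_ae_map hT.aemeasurable hae)
    exact absurd ((hsize hopt).symm.trans this) hα.2.ne
  obtain ⟨ψ, l, u, hψm, hψ01, hae, hlu, hdeg, hform⟩ := hφ.exists_ae_eq_form hφm hν
  have hopt' := hopt.congr_ae hh hh0 ⟨hψm.comp hT, fun y => hψ01 (T y)⟩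
    (ae_of_ae_map hT.aemeasurable hae)
  exact ⟨_, hopt', hsize hopt', l, u, fun y => ψ (T y), hlu, hdeg, hψm.comp hT,
    fun y => hψ01 (T y), fun y => ⟨(hform (T y)).1, fun _ => rfl, (hform (T y)).2⟩⟩
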